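/- A Petri net with $\omega$-arcs ($\omega$PN) is a tuple $\mathcal N=\langle P,T,m_0\rangle$, where $P$ is a finite set of places, $T$ is a finite set of transitions $t=(I(t),O(t))$ with $I(t),O(t):P\to\mathbb N\cup\{\omega\}$, and $m_0:P\to\mathbb N$ is the initial marking. For markings $m,m':P\to\mathbb N$ write $m\xrightarrow{t}m'$ if $m(p)\ge I(t)(p)$ for all $p$ with $I(t)(p)\ne\omega$, and for every $p$ we have $m'(p)=m(p)-i+o$, where $i=I(t)(p)$ if $I(t)(p)\neq\omega$ and $i\in\{0,\dots,m(p)\}$ is arbitrary otherwise, and $o=O(t)(p)$ if $O(t)(p)\ne\omega$ and $o\in\mathbb N$ is arbitrary otherwise. A self-covering execution of $\mathcal N$ is a finite sequence $m_0\xrightarrow{t_1}m_1\cdots\xrightarrow{t_n}m_n$ with $t_1,\dots,t_n\in T$ such that $m_k\le m_n$ (pointwise) for some $0\le k<n$; its transition sequence $t_1\cdots t_n$ has length $n$. Let $\mathrm{effect}(t)(p)=O(t)(p)-I(t)(p)$, with the conventions $\omega-x=\omega$ for all $x\in\mathbb N\cup\{\omega\}$ and $o-\omega=o$ for $o\in\mathbb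 N$. Let $R$ be the maximum of $1$, of all $I(t)(p)$ with $t\in T$, $p\in P$, $I(t)(p)\ne\omega$, and of all $|\mathrm{effect}(t)(p)|$ with $t\in T$, $p\in P$, $\mathrm{effect}(t)(p)\neq\omega$. For a constant $c\in\mathbb N$ define $\ell:\mathbb N\to\mathbb N$ by $$\ell(0)=(2R)^{c|P|^3},\qquad h_1(i+1)=2R\,\ell(i),\qquad \ell(i+1)=\bigl(h_1(i+1)\cdot 2R\bigr)^{c|P|^3}.$$ There is a constant $c\in\mathbb N$, independent of the net, such that for every $\omega$PN $\mathcal N=\langle P,T,m_0\rangle$: if $\mathcal N$ admits a self-covering execution, then it admits one whose transition sequence has length at most $\ell(|P|)$. Moreover, with $k=3c$, $\ell(i)\le(2R)^{k^{i+1}|P|^{3(i+1)}}$ for all $i\in\mathbb N$; in particular $\ell(|P|)\le(2R)^{k^{|P|+1}|P|^{3(|P|+1)}}$. -/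

import Mathlib

/-- A transition of a Petri net with `ω`-arcs over the set of places `P`: a pair `(I, O)` of
functions `P → ℕ ∪ {ω}`. The value `ω` is `⊤ : ℕ∞`. -/
structure OmegaTransition (P : Type*) where
  /-- input arcs -/
  I : P → ℕ∞
  /-- output arcs -/
  O : P → ℕ∞

/-- An initialised Petri net with `ω`-arcs `⟨P, T, m₀⟩`. -/
structure OmegaPN (P : Type*) where
  /-- the finite set of transitions -/
  T : Finset (OmegaTransition P)
  /-- the initial marking -/
  m₀ : P → ℕ

namespace OmegaTransition

/-- The maximal possible effect `O(p) - I(p)` of a transition on the place `p`, where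
`ω - x = ω` for every `x` (also for `x = ω`), and `o - ω = o` for finite `o`. -/
noncomputable def effect {P : Type*} (t : OmegaTransition P) (p : P) : WithTop ℤ :=
  open Classical in
  if t.O p = ⊤ then ⊤
  else if t.I p = ⊤ then (((t.O p).toNat : ℤ) : WithTop ℤ)
  else ((((t.O p).toNat : ℤ) - ((t.I p).toNat : ℤ) : ℤ) : WithTop ℤ)

/-- Concrete semantics: the transition `t` is firable in the marking `m`, and firing it may
yield `m'`. In every place `p`, `i p` tokens are consumed and `o p` tokens are produced; `i p` is
`I(p)` if that is finite, and any number in `{0, …, m(p)}` otherwise; `o p` is `O(p)` if that is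
finite, and any natural number otherwise. (The condition `i p ≤ m p` is firability in the places
with finite `I(p)`.) -/
def Step {P : Type*} (t : OmegaTransition P) (m m' : P → ℕ) : Prop :=
  ∃ i o : P → ℕ, ∀ p,
    i p ≤ m p ∧
    (t.I p ≠ ⊤ → (i p : ℕ∞) = t.I p) ∧
    (t.O p ≠ ⊤ → (o p : ℕ∞) = t.O p) ∧
    m' p = m p - i p + o p

end OmegaTransition

namespace OmegaPN

/-- `N.Fires m σ m'`: there is a finite run of the net from the marking `m` to the marking `m'`
whose sequence of transitions is `σ`. -/
inductive Fires {P : Type*} (N : OmegaPN P) :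
    (P → ℕ) → List (OmegaTransition P) → (P → ℕ) → Prop
  | nil (m : P → ℕ) : Fires N m [] m
  | cons {m m' m'' : P → ℕ} {t : OmegaTransition P} {σ : List (OmegaTransition P)} :
      t ∈ N.T → t.Step m m' → Fires N m' σ m'' → Fires N m (t :: σ) m''

/-- `σ` is the sequence of transitions `t₁ ⋯ tₙ` of a self-covering execution
`m₀ → m₁ → ⋯ → m_k → ⋯ → mₙ`, i.e. one with `m_k ≤ mₙ` for some `k < n`. -/
def IsSelfCovering {P : Type*} (N : OmegaPN P) (σ : List (OmegaTransition P)) : Prop :=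
  ∃ (σ₁ σ₂ : List (OmegaTransition P)) (m m' : P → ℕ),
    σ = σ₁ ++ σ₂ ∧ σ₂ ≠ [] ∧ N.Fires N.m₀ σ₁ m ∧ N.Fires m σ₂ m' ∧ m ≤ m'

/-- The constant `R`: the maximum of `1`, of all finite input weights `I(t)(p)` and of all `|effect(t)(p)|`
with `effect(t)(p) < ω` (infinite values contribute `0`). -/
noncomputable def R {P : Type*} [Fintype P] (N : OmegaPN P) : ℕ :=
  max 1 (N.T.sup fun t => Finset.univ.sup fun p =>
    max (t.I p).toNat ((t.effect p).untopD 0).natAbs)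

end OmegaPN

/-- The length function `ℓ` for the constants `c`, `R` and `q = |P|`:
`ℓ(0) = (2R)^(c q³)` and `ℓ(i+1) = (h₁(i+1) · 2R)^(c q³)` where `h₁(i+1) = 2 R ℓ(i)`. -/
def rackoffEll (c R q : ℕ) : ℕ → ℕ
  | 0 => (2 * R) ^ (c * q ^ 3)
  | i + 1 => ((2 * R * rackoffEll c R q i) * (2 * R)) ^ (c * q ^ 3)

/-! The proof is Rackoff's induction on the number of places that are required to stay nonnegative.
Runs are first normalised: an `ω`-input consumes nothing and every `ω`-output produces the same
number `M` of tokens. Extra tokens never hurt, so `M` can be raised at any time, and a real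
self-covering run corresponds to a normalised one for some `M`.

Let `S` have `i + 1` places and put `h = 2Rℓ(i)`. If some place `p` of `S` reaches `h`, the run up
to that moment is shortened by cutting cycles in the finite graph of markings on `S` below `h`. From
there `p` can be forgotten: `ℓ(i)` transitions, each needing at most `R` tokens, cannot exhaust it,
and the induction hypothesis supplies the rest (`exists_short_selfCovers`).

If all of `S` stays below `h`, the covering part is a walk in a graph with at most `h^|P|` vertices,
and its total effect must stay nonnegative on all places (`SelfCovers.exists_short_of_bounded`). The
walk is split into a short walk through the same vertices and a multiset of short closed walks
(`exists_skeleton`). Only the sum of the loop weights matters, so the multiset is replaced by a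
small one (`exists_small_multiset_sum_eq`), an integer-programming bound derived from Siegel's
lemma, and the loops are reinserted. -/

/-! ### Small integer solutions of linear systems. -/

/-- Siegel's lemma needs fewer equations than unknowns. Passing to a maximal independent set of rows
ensures this, because the nonzero solution `x` forces the rank below `card κ`. -/
theorem exists_small_kernel_vector {ι κ : Type*} [Fintype ι] [Fintype κ] (A : ι → κ → ℤ) (K : ℕ)
    (hK : 1 ≤ K) (hA : ∀ i j, |A i j| ≤ K) (x : κ → ℤ) (hx0 : x ≠ 0)
    (hx : ∀ i, ∑ j, A i j * x j = 0) :
    ∃ y : κ → ℤ, y ≠ 0 ∧ (∀ i, ∑ j, A i j * y j = 0) ∧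
      ∀ j, |y j| ≤ ((Fintype.card κ * K) ^ Fintype.card ι : ℕ) := by
  classical
  let row : ι → κ → ℚ := fun i j => A i j
  let φ : (κ → ℤ) → (κ → ℚ) →ₗ[ℚ] ℚ := fun y => ∑ j, (y j : ℚ) • LinearMap.proj j
  have hφ : ∀ y i, φ y (row i) = ((∑ j, A i j * y j : ℤ) : ℚ) := by
    intro y i
    simp only [φ, row, LinearMap.sum_apply, LinearMap.smul_apply, LinearMap.proj_apply, smul_eq_mul]
    push_cast
    exact Finset.sum_congr rfl fun j _ => mul_comm _ _
  have hφs : ∀ (y : κ → ℤ) j, φ y (Pi.single j 1) = y j := by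
    intro y j
    simp [φ, LinearMap.sum_apply, Pi.single_apply]
  obtain ⟨j₀, hj₀⟩ : ∃ j, x j ≠ 0 := by
    by_contra! h
    exact hx0 (funext h)
  obtain ⟨κ', a, ha, hspan, hli⟩ := exists_linearIndependent' ℚ row
  have : Finite κ' := Finite.of_injective a ha
  have := Fintype.ofFinite κ'
  have hker : ∀ y : κ → ℤ, (∀ k, ∑ j, A (a k) j * y j = 0) → ∀ i, ∑ j, A i j * y j = 0 := by
    intro y hy i
    have h1 : Submodule.span ℚ (Set.range row) ≤ LinearMap.ker (φ y) := by
      rw [← hspan, Submodule.span_le]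
      rintro _ ⟨k, rfl⟩
      simp only [Function.comp, SetLike.mem_coe, LinearMap.mem_ker]
      rw [hφ, hy k, Int.cast_zero]
    have h2 : φ y (row i) = 0 := h1 (Submodule.subset_span ⟨i, rfl⟩)
    rw [hφ] at h2
    exact_mod_cast h2
  have hcard : Fintype.card κ' ≤ Fintype.card ι := Fintype.card_le_of_injective a ha
  have hlt : Fintype.card κ' < Fintype.card κ := by
    rw [← finrank_span_eq_card hli, ← Module.finrank_fintype_fun_eq_card (R := ℚ) (η := κ)]
    apply Submodule.finrank_lt
    intro h
    have h1 : Submodule.span ℚ (Set.range (row ∘ a)) ≤ LinearMap.ker (φ x) := by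
      rw [Submodule.span_le]
      rintro _ ⟨k, rfl⟩
      simp only [Function.comp, SetLike.mem_coe, LinearMap.mem_ker]
      rw [hφ, hx, Int.cast_zero]
    rw [h] at h1
    have h2 : φ x (Pi.single j₀ 1) = 0 := h1 trivial
    rw [hφs] at h2
    exact hj₀ (by exact_mod_cast h2)
  have hpos : 1 ≤ Fintype.card κ * K := Nat.mul_pos (by omega) hK
  -- Siegel's lemma requires at least one equation; with none, a unit vector serves.
  rcases Nat.eq_zero_or_pos (Fintype.card κ') with h0 | h0
  · have := Fintype.card_eq_zero_iff.1 h0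
    refine ⟨Pi.single j₀ 1, ?_, hker _ fun k => (IsEmpty.false k).elim, fun j => ?_⟩
    · intro h
      simpa using congrFun h j₀
    · have h1 : (1 : ℤ) ≤ ((Fintype.card κ * K) ^ Fintype.card ι : ℕ) := by
        exact_mod_cast Nat.one_le_pow _ _ hpos
      by_cases h : j = j₀
      · subst h; simpa using h1
      · rw [Pi.single_eq_of_ne h, abs_zero]; omega
  · obtain ⟨y, hy0, hy, hyn⟩ :=
      Int.Matrix.exists_ne_zero_int_vec_norm_le (Matrix.of fun k j => A (a k) j) hlt h0
    refine ⟨y, hy0, hker y fun k => congrFun hy k, fun j => ?_⟩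
    have hn : max 1 (@norm (Matrix κ' κ ℤ) Matrix.seminormedAddCommGroup.toNorm
        (Matrix.of fun k j => A (a k) j)) ≤ (K : ℝ) := by
      apply max_le
      · exact_mod_cast hK
      · let : SeminormedAddCommGroup (Matrix κ' κ ℤ) := Matrix.seminormedAddCommGroup
        rw [Matrix.norm_le_iff (by positivity)]
        intro k j
        rw [Int.norm_eq_abs]
        exact_mod_cast hA (a k) j
    have h1 : ((|y j| : ℤ) : ℝ) ≤ ‖y‖ := by
      have := norm_le_pi_norm y j
      rwa [Int.norm_eq_abs, ← Int.cast_abs] at this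
    have hb : (1 : ℝ) ≤ Fintype.card κ * K := by exact_mod_cast hpos
    have h2 : ((|y j| : ℤ) : ℝ) ≤ ((Fintype.card κ : ℝ) * K) ^ (Fintype.card ι : ℝ) := by
      refine h1.trans (hyn.trans ?_)
      refine (Real.rpow_le_rpow (by positivity)
        (mul_le_mul_of_nonneg_left hn (by positivity)) ?_).trans
        (Real.rpow_le_rpow_of_exponent_le hb ?_)
      -- The Siegel exponent is `r / (n - r)` with `r < n`, hence at most `r`.
      · have : (Fintype.card κ' : ℝ) < Fintype.card κ := by exact_mod_cast hlt
        apply div_nonneg <;> linarith [(Nat.cast_nonneg (Fintype.card κ') : (0 : ℝ) ≤ _)]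
      · have h3 : (Fintype.card κ' : ℝ) + 1 ≤ Fintype.card κ := by exact_mod_cast hlt
        have h4 : (Fintype.card κ' : ℝ) ≤ Fintype.card ι := by exact_mod_cast hcard
        exact (div_le_self (Nat.cast_nonneg _) (by linarith)).trans h4
    rw [Real.rpow_natCast] at h2
    exact_mod_cast h2

/-- A family of more than `card ι` integer vectors indexed by `ι` is linearly dependent. -/
theorem exists_int_relation_of_card_lt {ι κ : Type*} [Fintype ι] [Fintype κ] (A : ι → κ → ℤ)
    (h : Fintype.card ι < Fintype.card κ) :
    ∃ y : κ → ℤ, y ≠ 0 ∧ ∀ i, ∑ j, A i j * y j = 0 := by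
  rcases Nat.eq_zero_or_pos (Fintype.card ι) with h0 | h0
  · have := Fintype.card_eq_zero_iff.1 h0
    obtain ⟨j⟩ := Fintype.card_pos_iff.1 (h0 ▸ h)
    exact ⟨1, fun h1 => one_ne_zero (congrFun h1 j), fun i => isEmptyElim i⟩
  · obtain ⟨y, hy0, hy, -⟩ := Int.Matrix.exists_ne_zero_int_vec_norm_le (Matrix.of A) h h0
    exact ⟨y, hy0, fun i => congrFun hy i⟩

/-- A nonnegative integer solution of `∑ x j • a j = t` can be replaced by a small one. -/
theorem exists_small_nat_solution {ι : Type*} [Fintype ι] {N : ℕ} (a : Fin N → ι → ℤ) (K B L T : ℕ)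
    (hK : 1 ≤ K) (ha : ∀ j i, |a j i| ≤ K) (t : ι → ℤ) (ht : ∀ i, |t i| ≤ B)
    (hL : L = ((Fintype.card ι + 1) * K) ^ Fintype.card ι) (hT : T = B + N * L * K)
    (x₀ : Fin N → ℕ) (hx₀ : ∀ i, ∑ j, a j i * (x₀ j : ℤ) = t i) :
    ∃ x : Fin N → ℕ, (∀ i, ∑ j, a j i * (x j : ℤ) = t i) ∧
      ∀ j, x j ≤ ((Fintype.card ι + 1) * (T + K)) ^ Fintype.card ι := by
  classical
  -- Take the lexicographically least solution. Entries below `L` are already small; `J` collects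
  -- the others.
  obtain ⟨x, hx, hmin⟩ := WellFounded.has_min
    (Pi.Lex.wellFounded (ι := Fin N) (α := fun _ => ℕ) (s := fun _ => (· < ·)) (· < ·) fun _ => wellFounded_lt)
    {x : Fin N → ℕ | ∀ i, ∑ j, a j i * (x j : ℤ) = t i} ⟨x₀, hx₀⟩
  simp only [Set.mem_ofPred_eq] at hx hmin
  let J : Finset (Fin N) := Finset.univ.filter fun j => L ≤ x j
  -- Adding a kernel vector supported on `J` with entries at most `L` keeps `x` nonnegative, so by
  -- minimality its first nonzero entry is not negative. Applied to `y` and `-y`, this gives `y =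
  -- 0`.
  have hneg : ∀ y : Fin N → ℤ, (∀ j ∉ J, y j = 0) → (∀ j, |y j| ≤ L) →
      (∀ i, ∑ j, a j i * y j = 0) → ∀ j₀, (∀ j < j₀, y j = 0) → ¬ y j₀ < 0 := by
    intro y hyJ hyL hy j₀ hj₀ hlt
    have hnn : ∀ j, 0 ≤ (x j : ℤ) + y j := by
      intro j
      by_cases hj : j ∈ J
      · have h1 : L ≤ x j := (Finset.mem_filter.1 hj).2
        have h2 := (abs_le.1 (hyL j)).1
        omega
      · rw [hyJ j hj]; omega
    refine hmin (fun j => ((x j : ℤ) + y j).toNat) (fun i => ?_) ⟨j₀, fun j hj => ?_, ?_⟩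
    · rw [← hx i, ← add_zero (∑ j, a j i * (x j : ℤ)), ← hy i, ← Finset.sum_add_distrib]
      refine Finset.sum_congr rfl fun j _ => ?_
      rw [Int.toNat_of_nonneg (hnn j), mul_add]
    · show ((x j : ℤ) + y j).toNat = x j
      rw [hj₀ j hj]; simp
    · show ((x j₀ : ℤ) + y j₀).toNat < x j₀
      have := hnn j₀
      omega
  have hzero : ∀ y : Fin N → ℤ, (∀ j ∉ J, y j = 0) → (∀ j, |y j| ≤ L) →
      (∀ i, ∑ j, a j i * y j = 0) → y = 0 := by
    intro y hyJ hyL hy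
    funext j
    induction j using WellFoundedLT.induction with
    | ind j ih =>
      have h1 := hneg y hyJ hyL hy j ih
      have h2 := hneg (-y) (fun j hj => by simp [hyJ j hj]) (fun j => by simpa using hyL j)
        (fun i => by simp [hy i]) j (fun k hk => by simpa using ih k hk)
      simp only [Pi.neg_apply, Pi.zero_apply] at h2 ⊢
      omega
  -- `L` is the Siegel bound for `d + 1` columns, where `d = card ι`: a dependency among that many
  -- columns of `J` would yield a kernel vector excluded by `hzero`. Hence `J` has at most `d`
  -- elements and independent columns.
  have hindep : ∀ F : Finset (Fin N), F ⊆ J → F.card ≤ Fintype.card ι + 1 →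
      ∀ y : F → ℤ, (∀ i, ∑ j : F, a j i * y j = 0) → y = 0 := by
    intro F hFJ hFc y hy
    by_contra hy0
    obtain ⟨z, hz0, hz, hzb⟩ := exists_small_kernel_vector (fun i (j : F) => a j i) K hK
      (fun i j => ha j i) y hy0 hy
    have hsupp : (fun j => if h : j ∈ F then z ⟨j, h⟩ else 0) = (0 : Fin N → ℤ) := by
      refine hzero _ (fun j hj => dif_neg fun h => hj (hFJ h)) (fun j => ?_) fun i => ?_
      · by_cases h : j ∈ F
        · rw [dif_pos h]
          refine (hzb _).trans ?_
          rw [hL, Fintype.card_coe]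
          exact_mod_cast Nat.pow_le_pow_left (Nat.mul_le_mul_right K hFc) _
        · rw [dif_neg h, abs_zero]; omega
      · refine Eq.trans ?_ (hz i)
        rw [Finset.univ_eq_attach, ← Finset.sum_subset (Finset.subset_univ F), ← Finset.sum_attach]
        · refine Finset.sum_congr rfl fun j _ => ?_
          rw [dif_pos j.2]
        · intro j _ hj
          rw [dif_neg hj, mul_zero]
    apply hz0
    funext j
    have := congrFun hsupp j
    simpa using this
  have hJc : J.card ≤ Fintype.card ι := by
    by_contra h
    obtain ⟨F, hFJ, hFc⟩ := Finset.exists_subset_card_eq (show Fintype.card ι + 1 ≤ J.card by omega)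
    obtain ⟨y, hy0, hy⟩ := exists_int_relation_of_card_lt (fun i (j : F) => a j i)
      (by rw [Fintype.card_coe]; omega)
    exact hy0 (hindep F hFJ hFc.le y hy)
  have hsplit : ∀ i, ∑ j : J, a j i * (x j : ℤ) = t i - ∑ j ∈ Jᶜ, a j i * (x j : ℤ) := by
    intro i
    rw [← hx i, ← Finset.sum_add_sum_compl J, add_sub_cancel_right, Finset.univ_eq_attach,
      Finset.sum_attach J fun j => a j i * (x j : ℤ)]
  -- Adjoin the contribution of the large entries as an extra column, bounded by `T`. The kernel
  -- contains `(-1, x)`, and by independence every kernel vector is a multiple of it, so a small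
  -- integer one bounds the entries of `x` on `J`.
  let A : ι → Option J → ℤ := fun i o => o.elim (∑ j : J, a j i * (x j : ℤ)) fun j => a j i
  have hAb : ∀ i o, |A i o| ≤ ((T + K : ℕ) : ℤ) := by
    rintro i (_ | j)
    · simp only [A, Option.elim_none]
      rw [hsplit]
      refine (abs_sub _ _).trans ?_
      have h1 : |∑ j ∈ Jᶜ, a j i * (x j : ℤ)| ≤ (N * L * K : ℕ) := by
        refine (Finset.abs_sum_le_sum_abs _ _).trans ?_
        refine (Finset.sum_le_card_nsmul _ _ ((K * L : ℕ) : ℤ) fun j hj => ?_).trans ?_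
        · rw [abs_mul]
          push_cast
          refine mul_le_mul (ha j i) ?_ (abs_nonneg _) (by positivity)
          have : ¬ L ≤ x j := fun h => by
            simp only [J, Finset.mem_compl, Finset.mem_filter, Finset.mem_univ, true_and] at hj
            exact hj h
          rw [Nat.abs_cast]
          omega
        · rw [nsmul_eq_mul]
          have h2 : (Jᶜ).card ≤ N := (Finset.card_le_univ _).trans (by simp)
          have h3 := Nat.mul_le_mul_right (K * L) h2
          calc ((Jᶜ).card : ℤ) * ((K * L : ℕ) : ℤ) ≤ ((N * (K * L) : ℕ) : ℤ) := by exact_mod_cast h3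
            _ = _ := by push_cast; ring
      have := ht i
      rw [hT]
      push_cast at *
      omega
    · simp only [A, Option.elim_some]
      refine (ha j i).trans ?_
      push_cast
      omega
  obtain ⟨y, hy0, hy, hyb⟩ := exists_small_kernel_vector A (T + K) (by omega) hAb
    (fun o => o.elim (-1) fun j => (x j : ℤ))
    (fun h => by simpa using congrFun h none) (fun i => by simp [A, Fintype.sum_option])
  have hcO : Fintype.card (Option J) ≤ Fintype.card ι + 1 := by
    rw [Fintype.card_option, Fintype.card_coe]; omega
  have hyb' : ∀ o, |y o| ≤ (((Fintype.card ι + 1) * (T + K)) ^ Fintype.card ι : ℕ) := fun o =>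
    (hyb o).trans (by exact_mod_cast Nat.pow_le_pow_left (Nat.mul_le_mul_right _ hcO) _)
  simp only [A, Fintype.sum_option, Option.elim_none, Option.elim_some] at hy
  have hnone : y none ≠ 0 := by
    intro h
    have h1 := hindep J subset_rfl (by omega) (fun j => y (some j)) fun i => by
      have := hy i
      rwa [h, mul_zero, zero_add] at this
    apply hy0
    funext o
    rcases o with _ | j
    · exact h
    · exact congrFun h1 j
  have hrel := hindep J subset_rfl (by omega) (fun j => y none * x j + y (some j)) fun i => by
    rw [← hy i, Finset.sum_mul, ← Finset.sum_add_distrib]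
    exact Finset.sum_congr rfl fun j _ => by ring
  refine ⟨x, hx, fun j => ?_⟩
  by_cases hj : j ∈ J
  · have h1 : y none * x j + y (some ⟨j, hj⟩) = 0 := congrFun hrel ⟨j, hj⟩
    have h2 : |y none| * (x j : ℤ) = |y (some ⟨j, hj⟩)| := by
      rw [← Nat.abs_cast (x j), ← abs_mul, eq_neg_of_add_eq_zero_left h1, abs_neg]
    have h3 := hyb' (some ⟨j, hj⟩)
    have h4 : 1 ≤ |y none| := Int.one_le_abs hnone
    have h5 : (x j : ℤ) ≤ |y none| * (x j : ℤ) := le_mul_of_one_le_left (by positivity) h4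
    exact_mod_cast h5.trans (h2.le.trans h3)
  · have h1 : ¬ L ≤ x j := fun h => hj (Finset.mem_filter.2 ⟨Finset.mem_univ _, h⟩)
    have h2 : L ≤ ((Fintype.card ι + 1) * (T + K)) ^ Fintype.card ι :=
      hL ▸ Nat.pow_le_pow_left (Nat.mul_le_mul_left _ (by omega)) _
    omega

/-- The bound on the number of summands in `exists_small_multiset_sum_eq`. -/
def summandBound (d K B : ℕ) : ℕ :=
  (2 * K + 1) ^ d *
    ((d + 1) * (B + (2 * K + 1) ^ d * ((d + 1) * K) ^ d * K + K)) ^ d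

/-- At most `(2K + 1)^d` distinct vectors have entries in `[-K, K]`. The multiplicities of those
occurring in `s` solve a linear system, which has a small solution. -/
theorem exists_small_multiset_sum_eq {ι : Type*} [Fintype ι] (s : Multiset (ι → ℤ)) (K B : ℕ)
    (hK : 1 ≤ K) (hs : ∀ v ∈ s, ∀ i, |v i| ≤ K) (hB : ∀ i, |s.sum i| ≤ B) :
    ∃ s' : Multiset (ι → ℤ), (∀ v ∈ s', v ∈ s) ∧ s'.sum = s.sum ∧
      s'.card ≤ summandBound (Fintype.card ι) K B := by
  classical
  have hN : s.toFinset.card ≤ (2 * K + 1) ^ Fintype.card ι := by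
    have h1 : s.toFinset ⊆ Fintype.piFinset fun _ : ι => Finset.Icc (-(K : ℤ)) K := by
      intro v hv
      rw [Fintype.mem_piFinset]
      exact fun i => Finset.mem_Icc.2 (abs_le.1 (hs v (Multiset.mem_toFinset.1 hv) i))
    refine (Finset.card_le_card h1).trans ?_
    rw [Fintype.card_piFinset, Finset.prod_const, Finset.card_univ, Int.card_Icc]
    exact Nat.pow_le_pow_left (by omega) _
  let e := s.toFinset.equivFin
  let a : Fin s.toFinset.card → ι → ℤ := fun j => (e.symm j : ι → ℤ)
  have hmem : ∀ j, a j ∈ s := fun j => Multiset.mem_toFinset.1 (e.symm j).2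
  obtain ⟨x, hx, hxb⟩ := exists_small_nat_solution a K B _ _ hK (fun j i => hs _ (hmem j) i)
    s.sum hB rfl rfl (fun j => s.count (a j)) (fun i => by
      rw [Finset.sum_multiset_count s, Finset.sum_apply, ← Finset.sum_coe_sort s.toFinset,
        ← e.symm.sum_comp]
      exact Finset.sum_congr rfl fun j _ => by simp [a, mul_comm])
  refine ⟨∑ j, Multiset.replicate (x j) (a j), fun v hv => ?_, ?_, ?_⟩
  · obtain ⟨j, -, hj⟩ := Multiset.mem_sum.1 hv
    rw [Multiset.eq_of_mem_replicate hj]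
    exact hmem j
  · funext i
    rw [← hx i, Multiset.sum_sum, Finset.sum_apply]
    exact Finset.sum_congr rfl fun j _ => by simp [Multiset.sum_replicate, mul_comm]
  · rw [Multiset.card_sum]
    simp only [Multiset.card_replicate]
    refine (Finset.sum_le_card_nsmul _ _ _ fun j _ => hxb j).trans ?_
    rw [Finset.card_univ, Fintype.card_fin, smul_eq_mul, summandBound]
    gcongr

/-! ### Shortening walks in a finite graph. -/

section Walks

variable {V E ι : Type*} (src tgt : E → V)

/-- `IsWalk src tgt u w v`: the list of edges `w` is a walk from `u` to `v`. -/
def IsWalk : V → List E → V → Prop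
  | u, [], v => u = v
  | u, e :: w, v => src e = u ∧ IsWalk (tgt e) w v

theorem isWalk_append {u v : V} {a b : List E} :
    IsWalk src tgt u (a ++ b) v ↔ ∃ x, IsWalk src tgt u a x ∧ IsWalk src tgt x b v := by
  induction a generalizing u with
  | nil => simp [IsWalk]
  | cons e a ih => simp [IsWalk, ih, and_assoc]

theorem IsWalk.exists_split {u v x : V} {w : List E} (h : IsWalk src tgt u w v)
    (hx : x ∈ u :: w.map tgt) :
    ∃ a b, w = a ++ b ∧ IsWalk src tgt u a x ∧ IsWalk src tgt x b v := by
  induction w generalizing u with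
  | nil =>
    simp only [List.map_nil, List.mem_singleton] at hx
    subst hx
    exact ⟨[], [], rfl, rfl, h⟩
  | cons e w ih =>
    rcases List.mem_cons.1 hx with rfl | hx
    · exact ⟨[], e :: w, rfl, rfl, h⟩
    · obtain ⟨a, b, rfl, ha, hb⟩ := ih h.2 hx
      exact ⟨e :: a, b, rfl, ⟨h.1, ha⟩, hb⟩

/-- The vector `a` is the weight of a closed walk of length at most `n` at a vertex of `X`, all of
whose edges satisfy `Q`. -/
def IsLoopWeight (wt : E → ι → ℤ) (Q : E → Prop) (X : V → Prop) (n : ℕ) (a : ι → ℤ) : Prop :=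
  ∃ y l, X y ∧ IsWalk src tgt y l y ∧ (∀ e ∈ l, Q e) ∧ l.length ≤ n ∧ (l.map wt).sum = a

/-- Edges are read one at a time, keeping a `base` that visits every vertex seen (`Y`) and a simple
path `tail` after it. Returning to a vertex of `tail` cuts off a loop; a new vertex moves `tail`
into `base`, which grows by at most `X.card` edges; otherwise `tail` is extended. -/
theorem exists_skeleton_aux (wt : E → ι → ℤ) (Q : E → Prop) (X : Finset V) {u v : V} (w : List E)
    (hw : IsWalk src tgt u w v) (hQ : ∀ e ∈ w, Q e) (hX : ∀ x ∈ u :: w.map tgt, x ∈ X) :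
    ∃ (base tail : List E) (x : V) (Y : Finset V) (s : Multiset (ι → ℤ)),
      IsWalk src tgt u base x ∧ IsWalk src tgt x tail v ∧ (∀ e ∈ base, Q e) ∧ (∀ e ∈ tail, Q e) ∧
      (∀ y, y ∈ Y ↔ y ∈ u :: w.map tgt) ∧ (∀ y ∈ Y, y ∈ u :: base.map tgt) ∧
      base.length ≤ Y.card * X.card ∧
      (x :: tail.map tgt).Nodup ∧ (∀ y ∈ x :: tail.map tgt, y ∈ X) ∧
      (∀ a ∈ s, IsLoopWeight src tgt wt Q (· ∈ u :: w.map tgt) X.card a) ∧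
      (w.map wt).sum = (base.map wt).sum + (tail.map wt).sum + s.sum := by
  classical
  induction w using List.reverseRecOn generalizing v with
  | nil =>
    have huv : u = v := hw
    subst huv
    exact ⟨[], [], u, {u}, 0, rfl, rfl, by simp, by simp, by simp, by simp, by simp,
      by simp, by simpa using hX, by simp, by simp⟩
  | append_singleton w e ih =>
    obtain ⟨z, hw1, hsrc, htgt⟩ := (isWalk_append src tgt).1 hw
    change tgt e = v at htgt
    subst htgt
    obtain ⟨base, tail, x, Y, s, hb, ht, hQb, hQt, hY, hYb, hlen, hnd, htX, hs, hsum⟩ :=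
      ih hw1 (fun e he => hQ e (by simp [he])) (fun y hy => hX y (by
        simp only [List.map_append, List.mem_cons, List.mem_append] at hy ⊢; tauto))
    have hQe : Q e := hQ e (by simp)
    have htl : tail.length + 1 ≤ X.card := by
      have h1 : (x :: tail.map tgt).toFinset ⊆ X := fun y hy => htX y (List.mem_toFinset.1 hy)
      have h2 := Finset.card_le_card h1
      rw [List.toFinset_card_of_nodup hnd] at h2
      simpa using h2
    have hmono : ∀ a, IsLoopWeight src tgt wt Q (· ∈ u :: w.map tgt) X.card a →
        IsLoopWeight src tgt wt Q (· ∈ u :: (w ++ [e]).map tgt) X.card a := by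
      rintro a ⟨y, l, hy, h⟩
      refine ⟨y, l, ?_, h⟩
      simp only [List.map_append, List.mem_cons, List.mem_append] at hy ⊢
      tauto
    have he : IsWalk src tgt z [e] (tgt e) := ⟨hsrc, rfl⟩
    have heX : tgt e ∈ X := hX _ (by simp)
    by_cases hv : tgt e ∈ Y
    · have hY' : ∀ y, y ∈ Y ↔ y ∈ u :: (w ++ [e]).map tgt := by
        intro y
        have := hY y
        simp only [List.map_append, List.map_cons, List.map_nil, List.mem_cons, List.mem_append,
          List.not_mem_nil, or_false] at this ⊢
        constructor
        · tauto
        · rintro (h | h | rfl) <;> tauto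
      by_cases hvt : tgt e ∈ x :: tail.map tgt
      · obtain ⟨t1, t2, rfl, ht1, ht2⟩ := ht.exists_split src tgt hvt
        refine ⟨base, t1, x, Y, ((t2 ++ [e]).map wt).sum ::ₘ s, hb, ht1, hQb,
          fun e he => hQt e (by simp [he]), hY', hYb, hlen, ?_, ?_, ?_, ?_⟩
        · refine hnd.sublist ?_
          simp
        · intro y hy
          apply htX
          simp only [List.map_append, List.mem_cons, List.mem_append] at hy ⊢
          tauto
        · intro a ha
          rcases Multiset.mem_cons.1 ha with rfl | ha
          · refine ⟨tgt e, t2 ++ [e], by simp, (isWalk_append src tgt).2 ⟨z, ht2, he⟩, ?_, ?_, rfl⟩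
            · intro f hf
              rcases List.mem_append.1 hf with hf | hf
              · exact hQt f (by simp [hf])
              · rw [List.mem_singleton.1 hf]; exact hQe
            · simp only [List.length_append, List.length_singleton] at htl ⊢
              omega
          · exact hmono a (hs a ha)
        · rw [Multiset.sum_cons, List.map_append, List.sum_append, hsum]
          simp only [List.map_append, List.sum_append]
          abel
      · refine ⟨base, tail ++ [e], x, Y, s, hb, (isWalk_append src tgt).2 ⟨z, ht, he⟩, hQb, ?_,
          hY', hYb, hlen, ?_, ?_, fun a ha => hmono a (hs a ha), ?_⟩
        · intro f hf
          rcases List.mem_append.1 hf with hf | hf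
          · exact hQt f hf
          · rw [List.mem_singleton.1 hf]; exact hQe
        · rw [List.map_append, ← List.cons_append, List.map_singleton, List.nodup_append]
          refine ⟨hnd, by simp, ?_⟩
          intro a ha b hb hab
          rw [List.mem_singleton.1 hb] at hab
          exact hvt (hab ▸ ha)
        · intro y hy
          rw [List.map_append, ← List.cons_append, List.mem_append] at hy
          rcases hy with hy | hy
          · exact htX y hy
          · simp only [List.map_singleton, List.mem_singleton] at hy
            rw [hy]; exact heX
        · rw [List.map_append, List.sum_append, hsum]
          simp only [List.map_append, List.sum_append]
          abel
    · refine ⟨base ++ tail ++ [e], [], tgt e, insert (tgt e) Y, s,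
        (isWalk_append src tgt).2 ⟨z, (isWalk_append src tgt).2 ⟨x, hb, ht⟩, he⟩, rfl, ?_, by simp,
        ?_, ?_, ?_, by simp, by simpa using heX, fun a ha => hmono a (hs a ha), ?_⟩
      · intro f hf
        simp only [List.mem_append, List.mem_singleton] at hf
        rcases hf with (hf | hf) | rfl
        · exact hQb f hf
        · exact hQt f hf
        · exact hQe
      · intro y
        have := hY y
        simp only [List.map_append, List.map_cons, List.map_nil, List.mem_cons, List.mem_append,
          List.not_mem_nil, or_false, Finset.mem_insert] at this ⊢
        tauto
      · intro y hy
        have := hYb y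
        simp only [List.map_append, List.map_cons, List.map_nil, List.mem_cons, List.mem_append,
          List.not_mem_nil, or_false, Finset.mem_insert] at this hy ⊢
        tauto
      · rw [Finset.card_insert_of_notMem hv, add_mul, one_mul]
        simp only [List.length_append, List.length_singleton]
        omega
      · simp only [List.map_append, List.sum_append, hsum, List.map_cons, List.map_nil, List.sum_cons,
          List.sum_nil, add_zero]
        abel

/-- Since `w₀` still visits the base point of every loop removed, any multiset of these loops can be
inserted back. -/
theorem exists_skeleton (wt : E → ι → ℤ) (Q : E → Prop) (X : Finset V) {u v : V} (w : List E)
    (hw : IsWalk src tgt u w v) (hQ : ∀ e ∈ w, Q e) (hX : ∀ x ∈ u :: w.map tgt, x ∈ X) :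
    ∃ (w₀ : List E) (s : Multiset (ι → ℤ)),
      IsWalk src tgt u w₀ v ∧ (∀ e ∈ w₀, Q e) ∧ w₀.length ≤ X.card * X.card + X.card ∧
      (∀ a ∈ s, IsLoopWeight src tgt wt Q (· ∈ u :: w₀.map tgt) X.card a) ∧
      (w.map wt).sum = (w₀.map wt).sum + s.sum := by
  obtain ⟨base, tail, x, Y, s, hb, ht, hQb, hQt, hY, hYb, hlen, hnd, htX, hs, hsum⟩ :=
    exists_skeleton_aux src tgt wt Q X w hw hQ hX
  refine ⟨base ++ tail, s, (isWalk_append src tgt).2 ⟨x, hb, ht⟩, ?_, ?_, ?_, ?_⟩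
  · intro f hf
    rcases List.mem_append.1 hf with hf | hf
    · exact hQb f hf
    · exact hQt f hf
  · classical
    have h1 : (x :: tail.map tgt).toFinset ⊆ X := fun y hy => htX y (List.mem_toFinset.1 hy)
    have h2 := Finset.card_le_card h1
    rw [List.toFinset_card_of_nodup hnd] at h2
    have h3 : Y ⊆ X := fun y hy => hX y ((hY y).1 hy)
    have h4 := Nat.mul_le_mul_right X.card (Finset.card_le_card h3)
    simp only [List.length_cons, List.length_map, List.length_append] at h2 ⊢
    omega
  · intro a ha
    obtain ⟨y, l, hy, h⟩ := hs a ha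
    refine ⟨y, l, ?_, h⟩
    have := hYb y ((hY y).2 hy)
    simp only [List.map_append, List.mem_cons, List.mem_append] at this ⊢
    tauto
  · rw [hsum, List.map_append, List.sum_append]

theorem exists_walk_insert_loops (wt : E → ι → ℤ) (Q : E → Prop) (n : ℕ) {u v : V} (w₀ : List E)
    (hw₀ : IsWalk src tgt u w₀ v) (hQ : ∀ e ∈ w₀, Q e) (s : Multiset (ι → ℤ))
    (hs : ∀ a ∈ s, IsLoopWeight src tgt wt Q (· ∈ u :: w₀.map tgt) n a) :
    ∃ w : List E, IsWalk src tgt u w v ∧ (∀ e ∈ w, Q e) ∧ w.length ≤ w₀.length + s.card * n ∧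
      (∀ y ∈ u :: w₀.map tgt, y ∈ u :: w.map tgt) ∧
      (w.map wt).sum = (w₀.map wt).sum + s.sum := by
  induction s using Multiset.induction_on with
  | empty => exact ⟨w₀, hw₀, hQ, by simp, fun _ h => h, by simp⟩
  | cons a s ih =>
    obtain ⟨w, hw, hQw, hlen, hvis, hsum⟩ := ih fun b hb => hs b (Multiset.mem_cons_of_mem hb)
    obtain ⟨y, l, hy, hl, hQl, hll, rfl⟩ := hs a (Multiset.mem_cons_self _ _)
    obtain ⟨α, β, rfl, hα, hβ⟩ := hw.exists_split src tgt (hvis y hy)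
    refine ⟨α ++ (l ++ β), (isWalk_append src tgt).2 ⟨y, hα, (isWalk_append src tgt).2 ⟨y, hl, hβ⟩⟩,
      ?_, ?_, ?_, ?_⟩
    · intro f hf
      simp only [List.mem_append] at hf hQw
      rcases hf with hf | hf | hf
      · exact hQw f (Or.inl hf)
      · exact hQl f hf
      · exact hQw f (Or.inr hf)
    · simp only [List.length_append, Multiset.card_cons, add_mul, one_mul] at hlen ⊢
      omega
    · intro z hz
      have := hvis z hz
      simp only [List.map_append, List.mem_cons, List.mem_append] at this ⊢
      tauto
    · rw [Multiset.sum_cons, add_left_comm, ← hsum]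
      simp only [List.map_append, List.sum_append]
      abel

theorem abs_sum_map_le (wt : E → ι → ℤ) (R : ℕ) (w : List E) (h : ∀ e ∈ w, ∀ i, |wt e i| ≤ R)
    (i : ι) : |(w.map wt).sum i| ≤ (w.length * R : ℕ) := by
  induction w with
  | nil => simp
  | cons e w ih =>
    have h1 := ih fun f hf => h f (List.mem_cons_of_mem _ hf)
    have h2 := h e List.mem_cons_self i
    rw [List.map_cons, List.sum_cons, Pi.add_apply, List.length_cons, add_mul, one_mul]
    refine (abs_add_le _ _).trans ?_
    push_cast at *
    omega

/-- The bound on the length of walks in `exists_short_walk`. -/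
def walkBound (n R d : ℕ) : ℕ :=
  n * n + n + summandBound d (n * R) ((n * n + n) * R + R) * n

/-- A walk with weight at least `b` in a graph with at most `n` vertices can be replaced by a short
one. -/
theorem exists_short_walk [Fintype ι] (wt : E → ι → ℤ) (Q : E → Prop) (R : ℕ) (hR : 1 ≤ R)
    (hwt : ∀ e, Q e → ∀ i, |wt e i| ≤ R) (b : ι → ℤ) (hb : ∀ i, |b i| ≤ R) (X : Finset V)
    {u v : V} (w : List E) (hw : IsWalk src tgt u w v) (hQ : ∀ e ∈ w, Q e)
    (hX : ∀ x ∈ u :: w.map tgt, x ∈ X) (hwb : ∀ i, b i ≤ (w.map wt).sum i) :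
    ∃ w' : List E, IsWalk src tgt u w' v ∧ (∀ e ∈ w', Q e) ∧
      w'.length ≤ walkBound X.card R (Fintype.card ι) ∧ ∀ i, b i ≤ (w'.map wt).sum i := by
  classical
  have hn : 1 ≤ X.card := Finset.card_pos.2 ⟨u, hX u (by simp)⟩
  obtain ⟨w₀, s, hw₀, hQ₀, hlen₀, hs, hsum⟩ := exists_skeleton src tgt wt Q X w hw hQ hX
  -- Slack vectors `-e_p` turn the inequality into an equality of sums. Those in the small multiset
  -- that are not loop weights are finally dropped, which only increases the weight.
  let slack : Multiset (ι → ℤ) :=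
    ∑ p, Multiset.replicate ((w.map wt).sum p - b p).toNat (-Pi.single p 1)
  have hslack : slack.sum = b - (w.map wt).sum := by
    funext i
    simp only [slack, Multiset.sum_sum, Multiset.sum_replicate, Finset.sum_apply, Pi.smul_apply,
      Pi.neg_apply]
    simp only [Pi.single_apply, nsmul_eq_mul, mul_neg, mul_ite, mul_one, mul_zero,
      Finset.sum_neg_distrib, Finset.sum_ite_eq, Finset.mem_univ, if_true, Pi.sub_apply]
    have := hwb i
    omega
  have hmem : ∀ a ∈ slack, ∃ p, a = -Pi.single p 1 := by
    intro a ha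
    obtain ⟨p, -, hp⟩ := Multiset.mem_sum.1 ha
    exact ⟨p, Multiset.eq_of_mem_replicate hp⟩
  have htot : (s + slack).sum = b - (w₀.map wt).sum := by
    rw [Multiset.sum_add, hslack, hsum]; abel
  obtain ⟨s', hs'mem, hs'sum, hs'card⟩ := exists_small_multiset_sum_eq (s + slack) (X.card * R)
    ((X.card * X.card + X.card) * R + R) (Nat.mul_pos hn hR) (fun a ha i => by
      rcases Multiset.mem_add.1 ha with ha | ha
      · obtain ⟨y, l, -, -, hQl, hll, rfl⟩ := hs a ha
        refine (abs_sum_map_le wt R l (fun e he => hwt e (hQl e he)) i).trans ?_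
        exact_mod_cast Nat.mul_le_mul_right R hll
      · obtain ⟨p, rfl⟩ := hmem a ha
        have h1 : (1 : ℤ) ≤ (X.card * R : ℕ) := by exact_mod_cast Nat.mul_pos hn hR
        rw [Pi.neg_apply, abs_neg, Pi.single_apply]
        split_ifs
        · simpa using h1
        · rw [abs_zero]; omega) (fun i => by
      rw [htot, Pi.sub_apply]
      refine (abs_sub _ _).trans ?_
      have h1 := abs_sum_map_le wt R w₀ (fun e he => hwt e (hQ₀ e he)) i
      have h2 := hb i
      have h3 : ((w₀.length * R : ℕ) : ℤ) ≤ ((X.card * X.card + X.card) * R : ℕ) := by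
        exact_mod_cast Nat.mul_le_mul_right R hlen₀
      push_cast at *
      omega)
  obtain ⟨w', hw', hQ', hlen', -, hsum'⟩ := exists_walk_insert_loops src tgt wt Q X.card w₀ hw₀ hQ₀
    (s'.filter (· ∈ s)) fun a ha => hs a (Multiset.mem_filter.1 ha).2
  refine ⟨w', hw', hQ', ?_, fun i => ?_⟩
  · refine hlen'.trans (Nat.add_le_add hlen₀ (Nat.mul_le_mul_right _ ?_))
    exact (Multiset.card_le_card (Multiset.filter_le _ _)).trans hs'card
  · have h1 := Multiset.filter_add_not (· ∈ s) s'
    have h2 : (s'.filter fun a => a ∉ s).sum i ≤ 0 := by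
      have h3 : ∀ m : Multiset (ι → ℤ), (∀ a ∈ m, a i ≤ 0) → m.sum i ≤ 0 := by
        intro m
        induction m using Multiset.induction_on with
        | empty => simp
        | cons a m ih =>
          intro h
          have := ih fun c hc => h c (Multiset.mem_cons_of_mem hc)
          have := h a (Multiset.mem_cons_self _ _)
          rw [Multiset.sum_cons, Pi.add_apply]
          omega
      apply h3
      intro a ha
      obtain ⟨ha1, ha2⟩ := Multiset.mem_filter.1 ha
      obtain ⟨p, rfl⟩ := hmem a ((Multiset.mem_add.1 (hs'mem a ha1)).resolve_left ha2)
      rw [Pi.neg_apply, Pi.single_apply]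
      split_ifs <;> omega
    have h4 := congrFun hs'sum i
    rw [← h1, Multiset.sum_add, htot, Pi.add_apply, Pi.sub_apply] at h4
    rw [hsum', Pi.add_apply]
    omega

end Walks

/-! ### Normalised firing with a fixed `ω`-output. -/

namespace OmegaTransition

variable {P : Type*}

/-- The number of tokens needed in `p`, where an `ω`-arc consumes nothing. -/
def need (t : OmegaTransition P) (p : P) : ℕ := (t.I p).toNat

open Classical in
/-- The effect of `t` when `ω`-input arcs consume nothing and `ω`-output arcs produce `M` tokens. -/
noncomputable def effAt (M : ℕ) (t : OmegaTransition P) (p : P) : ℤ :=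
  (if t.O p = ⊤ then (M : ℤ) else ((t.O p).toNat : ℤ)) - t.need p

theorem effAt_of_ne_top {M : ℕ} {t : OmegaTransition P} {p : P} (h : t.O p ≠ ⊤) :
    t.effAt M p = ((t.O p).toNat : ℤ) - t.need p := by
  rw [effAt, if_neg h]

theorem effAt_of_eq_top {M : ℕ} {t : OmegaTransition P} {p : P} (h : t.O p = ⊤) :
    t.effAt M p = (M : ℤ) - t.need p := by
  rw [effAt, if_pos h]

theorem neg_need_le_effAt (M : ℕ) (t : OmegaTransition P) (p : P) :
    -(t.need p : ℤ) ≤ t.effAt M p := by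
  rw [effAt]; split_ifs <;> omega

theorem effAt_mono {M M' : ℕ} (h : M ≤ M') (t : OmegaTransition P) (p : P) :
    t.effAt M p ≤ t.effAt M' p := by
  rw [effAt, effAt]; split_ifs <;> omega

/-- The total effect of a sequence of transitions. -/
noncomputable def disp (M : ℕ) (σ : List (OmegaTransition P)) : P → ℤ := (σ.map (effAt M)).sum

@[simp] theorem disp_nil (M : ℕ) : disp M ([] : List (OmegaTransition P)) = 0 := rfl

@[simp] theorem disp_cons (M : ℕ) (t : OmegaTransition P) (σ : List (OmegaTransition P)) :
    disp M (t :: σ) = t.effAt M + disp M σ := by simp [disp]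

@[simp] theorem disp_append (M : ℕ) (σ τ : List (OmegaTransition P)) :
    disp M (σ ++ τ) = disp M σ + disp M τ := by simp [disp]

theorem disp_mono {M M' : ℕ} (h : M ≤ M') (σ : List (OmegaTransition P)) (p : P) :
    disp M σ p ≤ disp M' σ p := by
  induction σ with
  | nil => simp
  | cons t σ ih =>
    have := effAt_mono h t p
    simp only [disp_cons, Pi.add_apply]
    omega

/-- `σ` is firable from the integer marking `m` as far as the places in `S` are concerned. -/
def SFires (S : Finset P) (M : ℕ) : (P → ℤ) → List (OmegaTransition P) → Prop
  | _, [] => True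
  | m, t :: σ => (∀ p ∈ S, (t.need p : ℤ) ≤ m p) ∧ SFires S M (m + t.effAt M) σ

theorem sFires_append {S : Finset P} {M : ℕ} {m : P → ℤ} {σ τ : List (OmegaTransition P)} :
    SFires S M m (σ ++ τ) ↔ SFires S M m σ ∧ SFires S M (m + disp M σ) τ := by
  induction σ generalizing m with
  | nil => simp [SFires]
  | cons t σ ih => simp [SFires, ih, and_assoc, add_assoc]

theorem SFires.mono {S S' : Finset P} {M M' : ℕ} (hS : S' ⊆ S) (hM : M ≤ M')
    {σ : List (OmegaTransition P)} {m m' : P → ℤ} (hm : ∀ p ∈ S', m p ≤ m' p)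
    (h : SFires S M m σ) : SFires S' M' m' σ := by
  induction σ generalizing m m' with
  | nil => trivial
  | cons t σ ih =>
    refine ⟨fun p hp => (h.1 p (hS hp)).trans (hm p hp), ih (fun p hp => ?_) h.2⟩
    have := effAt_mono hM t p
    have := hm p hp
    simp only [Pi.add_apply]
    omega

theorem SFires.nonneg {S : Finset P} {M : ℕ} {σ : List (OmegaTransition P)} {m : P → ℤ}
    (hm : ∀ p ∈ S, 0 ≤ m p) (h : SFires S M m σ) : ∀ p ∈ S, 0 ≤ m p + disp M σ p := by
  induction σ generalizing m with
  | nil => simpa using hm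
  | cons t σ ih =>
    intro p hp
    have := ih (m := m + t.effAt M) (fun p hp => by
      have := h.1 p hp
      have := neg_need_le_effAt M t p
      simp only [Pi.add_apply]
      omega) h.2 p hp
    simp only [disp_cons, Pi.add_apply] at this ⊢
    omega

/-- Firability in a place holding many tokens. -/
theorem SFires.insert [DecidableEq P] {S : Finset P} {M R : ℕ} {p : P}
    {σ : List (OmegaTransition P)} {m : P → ℤ} (hR : ∀ t ∈ σ, t.need p ≤ R)
    (hm : (σ.length * R : ℕ) ≤ m p) (h : SFires (S.erase p) M m σ) : SFires S M m σ := by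
  induction σ generalizing m with
  | nil => trivial
  | cons t σ ih =>
    have h1 := hR t List.mem_cons_self
    rw [List.length_cons, add_mul, one_mul] at hm
    push_cast at hm
    have h3 : (0 : ℤ) ≤ σ.length * R := by positivity
    refine ⟨fun q hq => ?_, ih (fun s hs => hR s (List.mem_cons_of_mem _ hs)) ?_ h.2⟩
    · by_cases hqp : q = p
      · subst hqp; omega
      · exact h.1 q (Finset.mem_erase.2 ⟨hqp, hq⟩)
    · have := neg_need_le_effAt M t p
      simp only [Pi.add_apply]
      push_cast
      omega

end OmegaTransition

/-! ### Normalised runs versus real runs. -/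

namespace OmegaPN

open OmegaTransition

variable {P : Type*} [Fintype P]

theorem one_le_R (N : OmegaPN P) : 1 ≤ N.R := le_max_left _ _

theorem need_le_R (N : OmegaPN P) {t : OmegaTransition P} (ht : t ∈ N.T) (p : P) :
    t.need p ≤ N.R := by
  refine le_trans ?_ (le_max_right _ _)
  refine le_trans ?_ (Finset.le_sup (f := fun t : OmegaTransition P => Finset.univ.sup fun p =>
    max (t.I p).toNat ((t.effect p).untopD 0).natAbs) ht)
  exact le_trans (le_max_left _ _) (Finset.le_sup (f := fun p =>
    max (t.I p).toNat ((t.effect p).untopD 0).natAbs) (Finset.mem_univ p))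

theorem abs_effAt_le_R (N : OmegaPN P) {t : OmegaTransition P} (ht : t ∈ N.T) {p : P}
    (h : t.O p ≠ ⊤) (M : ℕ) : |t.effAt M p| ≤ N.R := by
  have h1 : ((t.effect p).untopD 0).natAbs ≤ N.R := by
    refine le_trans ?_ (le_max_right _ _)
    refine le_trans ?_ (Finset.le_sup (f := fun t : OmegaTransition P => Finset.univ.sup fun p =>
      max (t.I p).toNat ((t.effect p).untopD 0).natAbs) ht)
    exact le_trans (le_max_right _ _) (Finset.le_sup (f := fun p =>
      max (t.I p).toNat ((t.effect p).untopD 0).natAbs) (Finset.mem_univ p))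
  have h2 : (t.effect p).untopD 0 = t.effAt M p := by
    rw [effAt_of_ne_top h, effect, if_neg h, need]
    -- For an `ω`-input, `need` is `0` because `ENat.toNat ⊤ = 0`; this matches the convention `o -
    -- ω = o`.
    split_ifs with h3
    · rw [h3]
      simp only [ENat.toNat_top, Nat.cast_zero, sub_zero]
      rfl
    · rfl
  rw [h2] at h1
  rw [Int.abs_eq_natAbs]
  exact_mod_cast h1

theorem Fires.mem {P : Type*} {N : OmegaPN P} {m m' : P → ℕ} {σ : List (OmegaTransition P)}
    (h : N.Fires m σ m') : ∀ t ∈ σ, t ∈ N.T := by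
  induction h with
  | nil => simp
  | cons ht _ _ ih => simpa using ⟨ht, ih⟩

/-- Once `M` exceeds every amount actually produced along the run, the normalised run dominates it
in each place. -/
theorem Fires.exists_sFires {N : OmegaPN P} {m m' : P → ℕ} {σ : List (OmegaTransition P)}
    (h : N.Fires m σ m') : ∃ M₀, ∀ M ≥ M₀,
      SFires Finset.univ M (fun p => (m p : ℤ)) σ ∧ ∀ p, (m' p : ℤ) - m p ≤ disp M σ p := by
  induction h with
  | nil m => exact ⟨0, fun M _ => ⟨trivial, by simp⟩⟩
  | @cons m m' m'' t σ ht hstep _ ih =>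
    obtain ⟨M₀, hM₀⟩ := ih
    obtain ⟨i, o, hio⟩ := hstep
    refine ⟨max M₀ (Finset.univ.sup o), fun M hM => ?_⟩
    obtain ⟨h1, h2⟩ := hM₀ M (le_trans (le_max_left _ _) hM)
    have hneed : ∀ p, t.need p ≤ i p := by
      intro p
      by_cases h : t.I p = ⊤
      · simp [need, h]
      · rw [need, ← (hio p).2.1 h]; simp
    have heff : ∀ p, (m' p : ℤ) - m p ≤ t.effAt M p := by
      intro p
      obtain ⟨ha, -, hb, hc⟩ := hio p
      have hn := hneed p
      by_cases h : t.O p = ⊤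
      · have : o p ≤ M := (Finset.le_sup (Finset.mem_univ p)).trans (le_trans (le_max_right _ _) hM)
        rw [effAt_of_eq_top h]
        omega
      · rw [effAt_of_ne_top h, ← hb h, ENat.toNat_natCast]
        omega
    refine ⟨⟨fun p _ => ?_, h1.mono subset_rfl le_rfl fun p _ => ?_⟩, fun p => ?_⟩
    · have := hneed p
      have := (hio p).1
      show (t.need p : ℤ) ≤ m p
      omega
    · have := heff p
      simp only [Pi.add_apply]
      omega
    · have := heff p
      have := h2 p
      simp only [disp_cons, Pi.add_apply]
      omega

theorem exists_fires_of_sFires {N : OmegaPN P} {M : ℕ} {σ : List (OmegaTransition P)} {m : P → ℕ}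
    (hσ : ∀ t ∈ σ, t ∈ N.T) (h : SFires Finset.univ M (fun p => (m p : ℤ)) σ) :
    ∃ m' : P → ℕ, N.Fires m σ m' ∧ ∀ p, (m' p : ℤ) = m p + disp M σ p := by
  classical
  induction σ generalizing m with
  | nil => exact ⟨m, .nil m, by simp⟩
  | cons t σ ih =>
    have hneed : ∀ p, t.need p ≤ m p := fun p => by
      have : (t.need p : ℤ) ≤ m p := h.1 p (Finset.mem_univ p)
      exact_mod_cast this
    let m₁ : P → ℕ := fun p => m p - t.need p + if t.O p = ⊤ then M else (t.O p).toNat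
    have hm₁ : ∀ p, (m₁ p : ℤ) = m p + t.effAt M p := by
      intro p
      have := hneed p
      by_cases hO : t.O p = ⊤
      · rw [effAt_of_eq_top hO]; simp only [m₁, hO, if_true]; omega
      · rw [effAt_of_ne_top hO]; simp only [m₁, hO, if_false]; omega
    obtain ⟨m', hm', hd⟩ := ih (m := m₁) (fun s hs => hσ s (List.mem_cons_of_mem _ hs))
      (h.2.mono subset_rfl le_rfl fun p _ => by rw [hm₁]; exact le_rfl)
    refine ⟨m', .cons (hσ t List.mem_cons_self) ⟨t.need, fun p => if t.O p = ⊤ then M else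
      (t.O p).toNat, fun p => ⟨hneed p, fun hI => ?_, fun hO => ?_, rfl⟩⟩ hm', fun p => ?_⟩
    · exact ENat.natCast_toNat hI
    · beta_reduce
      rw [if_neg hO]; exact ENat.natCast_toNat hO
    · rw [hd, hm₁, disp_cons, Pi.add_apply]; ring

/-- A self-covering pseudo-execution in which only the places of `S` have to stay nonnegative. -/
def SelfCovers {P : Type*} (N : OmegaPN P) (S : Finset P) (M : ℕ) (m : P → ℤ)
    (σ τ : List (OmegaTransition P)) : Prop :=
  (∀ t ∈ σ ++ τ, t ∈ N.T) ∧ τ ≠ [] ∧ SFires S M m (σ ++ τ) ∧ ∀ p, 0 ≤ disp M τ p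

theorem IsSelfCovering.exists_selfCovers {N : OmegaPN P} {σ : List (OmegaTransition P)}
    (h : N.IsSelfCovering σ) :
    ∃ M σ₁ σ₂, N.SelfCovers Finset.univ M (fun p => (N.m₀ p : ℤ)) σ₁ σ₂ := by
  obtain ⟨σ₁, σ₂, m, m', -, hne, h1, h2, hle⟩ := h
  obtain ⟨M₁, hM₁⟩ := h1.exists_sFires
  obtain ⟨M₂, hM₂⟩ := h2.exists_sFires
  obtain ⟨hf1, hd1⟩ := hM₁ (max M₁ M₂) (le_max_left _ _)
  obtain ⟨hf2, hd2⟩ := hM₂ (max M₁ M₂) (le_max_right _ _)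
  refine ⟨max M₁ M₂, σ₁, σ₂, fun t ht => ?_, hne, sFires_append.2 ⟨hf1,
    hf2.mono subset_rfl le_rfl fun p _ => ?_⟩, fun p => ?_⟩
  · exact (List.mem_append.1 ht).elim (h1.mem t) (h2.mem t)
  · have := hd1 p
    simp only [Pi.add_apply]
    omega
  · have := hd2 p
    have : m p ≤ m' p := hle p
    omega

theorem SelfCovers.isSelfCovering {N : OmegaPN P} {M : ℕ} {σ₁ σ₂ : List (OmegaTransition P)}
    (h : N.SelfCovers Finset.univ M (fun p => (N.m₀ p : ℤ)) σ₁ σ₂) :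
    N.IsSelfCovering (σ₁ ++ σ₂) := by
  obtain ⟨hT, hne, hf, hd⟩ := h
  obtain ⟨hf1, hf2⟩ := sFires_append.1 hf
  obtain ⟨m, hm, hmd⟩ := exists_fires_of_sFires
    (fun t ht => hT t (List.mem_append_left _ ht)) hf1
  obtain ⟨m', hm', hmd'⟩ := exists_fires_of_sFires (m := m)
    (fun t ht => hT t (List.mem_append_right _ ht))
    (hf2.mono subset_rfl le_rfl fun p _ => by rw [hmd]; exact le_rfl)
  refine ⟨σ₁, σ₂, m, m', rfl, hne, hm, hm', fun p => ?_⟩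
  have := hmd' p
  have := hd p
  show m p ≤ m' p
  omega

theorem SelfCovers.mono {P : Type*} {N : OmegaPN P} {S S' : Finset P} {M M' : ℕ} (hS : S' ⊆ S) (hM : M ≤ M')
    {m : P → ℤ} {σ τ : List (OmegaTransition P)} (h : N.SelfCovers S M m σ τ) :
    N.SelfCovers S' M' m σ τ :=
  ⟨h.1, h.2.1, h.2.2.1.mono hS hM fun _ _ => le_rfl,
    fun p => (h.2.2.2 p).trans (disp_mono hM τ p)⟩

/-- A self-covering pseudo-execution that starts with `α` can be rearranged so that `α` ends before
the covering part begins. -/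
theorem SelfCovers.exists_after_prefix {P : Type*} {N : OmegaPN P} {S : Finset P} {M : ℕ} {m : P → ℤ}
    {σ τ α β : List (OmegaTransition P)} (h : N.SelfCovers S M m σ τ) (hαβ : σ ++ τ = α ++ β) :
    ∃ σ' τ', N.SelfCovers S M (m + disp M α) σ' τ' := by
  obtain ⟨hT, hne, hf, hd⟩ := h
  rcases List.append_eq_append_iff.1 hαβ with ⟨γ, rfl, rfl⟩ | ⟨γ, rfl, rfl⟩
  -- Here `α` ends inside `τ = γ ++ β`: finish `τ` with `β`, then run `τ` once more, which is
  -- possible because its effect is nonnegative.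
  · refine ⟨β, γ ++ β, fun t ht => hT t (by simp at ht ⊢; tauto), hne, ?_, hd⟩
    have hβ : SFires S M (m + disp M (σ ++ γ)) β :=
      (sFires_append.1 (by simpa using hf)).2
    refine sFires_append.2 ⟨hβ, (sFires_append.1 hf).2.mono subset_rfl le_rfl fun p _ => ?_⟩
    have := hd p
    simp only [disp_append, Pi.add_apply] at this ⊢
    omega
  · exact ⟨γ, τ, fun t ht => hT t (by simp at ht ⊢; tauto), hne,
      (sFires_append.1 (by simpa using hf)).2, hd⟩

end OmegaPN

/-! ### Bounded runs as walks in a finite graph. -/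

namespace OmegaPN

open OmegaTransition

variable {P : Type*}

open Classical in
/-- The marking `m` restricted to the places in `S`. -/
noncomputable def proj (S : Finset P) (m : P → ℤ) : P → ℤ := fun p => if p ∈ S then m p else 0

theorem proj_apply {S : Finset P} {p : P} (hp : p ∈ S) (m : P → ℤ) : proj S m p = m p := if_pos hp

theorem proj_congr {S : Finset P} {m m' : P → ℤ} (h : ∀ p ∈ S, m p = m' p) :
    proj S m = proj S m' := by
  funext p
  simp only [proj]
  split_ifs with hp
  · exact h p hp
  · rfl

theorem proj_eq_iff {S : Finset P} {m m' : P → ℤ} :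
    proj S m = proj S m' ↔ ∀ p ∈ S, m p = m' p :=
  ⟨fun h p hp => by rw [← proj_apply hp m, h, proj_apply hp], proj_congr⟩

/-- The markings with values in `[0, h)`. -/
noncomputable def box (P : Type*) [Fintype P] (h : ℕ) : Finset (P → ℤ) := by
  classical exact Fintype.piFinset fun _ => Finset.Ico 0 (h : ℤ)

theorem mem_box [Fintype P] {h : ℕ} {v : P → ℤ} : v ∈ box P h ↔ ∀ p, 0 ≤ v p ∧ v p < h := by
  simp [box]

theorem card_box [Fintype P] (h : ℕ) : (box P h).card = h ^ Fintype.card P := by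
  classical
  rw [box, Fintype.card_piFinset, Finset.prod_const, Finset.card_univ, Int.card_Ico]
  simp

theorem proj_mem_box [Fintype P] {S : Finset P} {h : ℕ} (hh : 1 ≤ h) {m : P → ℤ}
    (hm : ∀ p ∈ S, 0 ≤ m p ∧ m p < h) : proj S m ∈ box P h := by
  rw [mem_box]
  intro p
  simp only [proj]
  split_ifs with hp
  · exact hm p hp
  · omega

/-- An edge of the graph of the restricted bounded markings. -/
abbrev Edge (P : Type*) := (P → ℤ) × OmegaTransition P × (P → ℤ)

/-- The edge `e` is a firing of a transition of `N` that leads to a marking bounded by `h`. -/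
def ValidEdge [Fintype P] (N : OmegaPN P) (S : Finset P) (M h : ℕ) (e : Edge P) : Prop :=
  e.2.1 ∈ N.T ∧ (∀ p ∈ S, (e.2.1.need p : ℤ) ≤ e.1 p) ∧ e.2.2 = proj S (e.1 + e.2.1.effAt M) ∧
    e.2.2 ∈ box P h

/-- With `h ≤ M`, an `ω`-output into a place of `S` would leave the box, so on `S` the edge does not
depend on `M`. -/
theorem ValidEdge.mono [Fintype P] {N : OmegaPN P} {S : Finset P} {M M' h : ℕ} (hM : h ≤ M)
    {e : Edge P} (he : N.ValidEdge S M h e) : N.ValidEdge S M' h e := by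
  obtain ⟨hT, hn, he, hb⟩ := he
  refine ⟨hT, hn, he.trans (proj_congr fun p hp => ?_), hb⟩
  have hO : e.2.1.O p ≠ ⊤ := by
    intro hO
    have h1 := (mem_box.1 hb p).2
    rw [he, proj_apply hp, Pi.add_apply, effAt_of_eq_top hO] at h1
    have := hn p hp
    omega
  rw [Pi.add_apply, Pi.add_apply, effAt_of_ne_top hO, effAt_of_ne_top hO]

theorem exists_isWalk_of_sFires [Fintype P] {N : OmegaPN P} {S : Finset P} {M h : ℕ} (hh : 1 ≤ h)
    {σ : List (OmegaTransition P)} {m : P → ℤ} (hσ : ∀ t ∈ σ, t ∈ N.T) (hm : ∀ p ∈ S, 0 ≤ m p)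
    (hf : SFires S M m σ) (hb : ∀ α β, σ = α ++ β → ∀ p ∈ S, m p + disp M α p < h) :
    ∃ w : List (Edge P), IsWalk (·.1) (·.2.2) (proj S m) w (proj S (m + disp M σ)) ∧
      w.map (·.2.1) = σ ∧ (∀ e ∈ w, N.ValidEdge S M h e) ∧
      ∀ x ∈ proj S m :: w.map (·.2.2), x ∈ box P h := by
  induction σ generalizing m with
  | nil =>
    refine ⟨[], ?_, rfl, by simp, ?_⟩
    · show proj S m = _
      simp
    · simp only [List.map_nil, List.mem_singleton, forall_eq]
      exact proj_mem_box hh fun p hp => ⟨hm p hp, by simpa using hb [] [] rfl p hp⟩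
  | cons t σ ih =>
    have hm' : ∀ p ∈ S, 0 ≤ (m + t.effAt M) p := by
      intro p hp
      have := hf.1 p hp
      have := neg_need_le_effAt M t p
      simp only [Pi.add_apply]
      omega
    obtain ⟨w, hw, hl, hv, hx⟩ := ih (m := m + t.effAt M)
      (fun s hs => hσ s (List.mem_cons_of_mem _ hs)) hm' hf.2 (fun α β hαβ p hp => by
        have := hb (t :: α) β (by rw [hαβ]; rfl) p hp
        simp only [disp_cons, Pi.add_apply] at this ⊢
        omega)
    refine ⟨(proj S m, t, proj S (m + t.effAt M)) :: w, ⟨rfl, ?_⟩, by simp [hl], ?_, ?_⟩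
    · simpa [add_assoc] using hw
    · intro e he
      rcases List.mem_cons.1 he with rfl | he
      · refine ⟨hσ t List.mem_cons_self, fun p hp => ?_, proj_congr fun p hp => ?_, hx _ (by simp)⟩
        · show (t.need p : ℤ) ≤ proj S m p
          rw [proj_apply hp]; exact hf.1 p hp
        · simp only [Pi.add_apply, proj_apply hp]
      · exact hv e he
    · intro x hx'
      rcases List.mem_cons.1 hx' with rfl | hx'
      · exact proj_mem_box hh fun p hp => ⟨hm p hp, by simpa using hb [] _ rfl p hp⟩
      · exact hx x hx'

theorem sFires_of_isWalk [Fintype P] {N : OmegaPN P} {S : Finset P} {M h : ℕ}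
    {w : List (Edge P)} {m : P → ℤ} {u v : P → ℤ} (hu : proj S m = proj S u)
    (hw : IsWalk (·.1) (·.2.2) u w v) (hv : ∀ e ∈ w, N.ValidEdge S M h e) :
    SFires S M m (w.map (·.2.1)) ∧ proj S (m + disp M (w.map (·.2.1))) = proj S v := by
  induction w generalizing m u with
  | nil =>
    have : u = v := hw
    subst this
    exact ⟨trivial, by simpa using hu⟩
  | cons e w ih =>
    obtain ⟨hsrc, hw⟩ := hw
    obtain ⟨-, hn, he, -⟩ := hv e List.mem_cons_self
    have hsrc : e.1 = u := hsrc
    rw [proj_eq_iff] at hu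
    have h1 := ih (m := m + e.2.1.effAt M) (u := e.2.2) (by
      rw [he, proj_eq_iff]
      intro p hp
      rw [proj_apply hp, hsrc, Pi.add_apply, Pi.add_apply, hu p hp]) hw
      fun f hf => hv f (List.mem_cons_of_mem _ hf)
    refine ⟨⟨fun p hp => ?_, h1.1⟩, ?_⟩
    · rw [hu p hp, ← hsrc]; exact hn p hp
    · rw [List.map_cons, disp_cons, ← add_assoc]; exact h1.2

/-- A firing sequence along markings bounded by `h` can be replaced by a short one with the same
final marking. -/
theorem exists_short_sFires [Fintype P] {N : OmegaPN P} {S : Finset P} {M h : ℕ} (hh : 1 ≤ h)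
    (hM : h ≤ M) {σ : List (OmegaTransition P)} {m : P → ℤ} (hσ : ∀ t ∈ σ, t ∈ N.T)
    (hm : ∀ p ∈ S, 0 ≤ m p) (hf : SFires S M m σ)
    (hb : ∀ α β, σ = α ++ β → ∀ p ∈ S, m p + disp M α p < h) :
    ∃ σ' : List (OmegaTransition P), (∀ t ∈ σ', t ∈ N.T) ∧
      σ'.length ≤ h ^ Fintype.card P * h ^ Fintype.card P + h ^ Fintype.card P ∧
      ∀ M', SFires S M' m σ' ∧ ∀ p ∈ S, m p + disp M' σ' p = m p + disp M σ p := by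
  obtain ⟨w, hw, -, hv, hx⟩ := exists_isWalk_of_sFires hh hσ hm hf hb
  -- Only the endpoints matter here, so the weights are trivial and the loops are discarded.
  obtain ⟨w', -, hw', hv', hlen, -⟩ := exists_skeleton _ _ (fun _ => (0 : Empty → ℤ))
    (N.ValidEdge S M h) (box P h) w hw hv hx
  refine ⟨w'.map (·.2.1), fun t ht => ?_, ?_, fun M' => ?_⟩
  · obtain ⟨e, he, rfl⟩ := List.mem_map.1 ht
    exact (hv' e he).1
  · rw [List.length_map, ← card_box]; exact hlen
  · obtain ⟨h1, h2⟩ := sFires_of_isWalk (m := m) (proj_congr fun p hp => (proj_apply hp m).symm) hw'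
      fun e he => (hv' e he).mono hM
    refine ⟨h1, fun p hp => ?_⟩
    have := congrFun h2 p
    rw [proj_apply hp, proj_apply hp, proj_apply hp] at this
    exact this

theorem le_disp_of_exists_top [Fintype P] {N : OmegaPN P} {M : ℕ} {τ : List (OmegaTransition P)}
    (hτ : ∀ t ∈ τ, t ∈ N.T) (p : P) :
    -(τ.length * N.R : ℕ) ≤ disp M τ p ∧
      ((∃ t ∈ τ, t.O p = ⊤) → (M : ℤ) - (τ.length * N.R : ℕ) ≤ disp M τ p) := by
  induction τ with
  | nil => simp
  | cons t τ ih =>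
    obtain ⟨h1, h2⟩ := ih fun s hs => hτ s (List.mem_cons_of_mem _ hs)
    have h3 := neg_need_le_effAt M t p
    have h4 := N.need_le_R (hτ t List.mem_cons_self) p
    rw [List.length_cons, add_mul, one_mul, disp_cons, Pi.add_apply, Nat.cast_add]
    refine ⟨by omega, ?_⟩
    rintro ⟨s, hs, hO⟩
    rcases List.mem_cons.1 hs with rfl | hs
    · rw [effAt_of_eq_top hO]; omega
    · have := h2 ⟨s, hs, hO⟩
      omega

open Classical in
/-- The weights used to shorten the covering part `τ`: the number of edges, the number of
`ω`-outputs for the places with an `ω`-output in `τ`, and the effect for the other places. -/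
noncomputable def coverWeight (τ : List (OmegaTransition P)) (t : OmegaTransition P) :
    Option P → ℤ
  | none => 1
  | some p => if ∃ s ∈ τ, s.O p = ⊤ then (if t.O p = ⊤ then 1 else 0) else t.effAt 0 p

theorem sum_coverWeight_none (τ σ : List (OmegaTransition P)) :
    (σ.map (coverWeight τ)).sum none = σ.length := by
  induction σ with
  | nil => rfl
  | cons t σ ih =>
    rw [List.map_cons, List.sum_cons, Pi.add_apply, ih, List.length_cons, coverWeight]
    push_cast; ring

theorem one_le_sum_coverWeight_iff {τ σ : List (OmegaTransition P)} {p : P}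
    (h : ∃ s ∈ τ, s.O p = ⊤) :
    0 ≤ (σ.map (coverWeight τ)).sum (some p) ∧
      (1 ≤ (σ.map (coverWeight τ)).sum (some p) ↔ ∃ s ∈ σ, s.O p = ⊤) := by
  induction σ with
  | nil => simp
  | cons t σ ih =>
    rw [List.map_cons, List.sum_cons, Pi.add_apply, coverWeight, if_pos h]
    simp only [List.mem_cons, exists_eq_or_imp]
    split_ifs with ht
    · simp only [ht, true_or, iff_true]; omega
    · simpa [ht] using ih

theorem sum_coverWeight_some {τ σ : List (OmegaTransition P)} {p : P} (M : ℕ)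
    (h : ¬ ∃ s ∈ τ, s.O p = ⊤) (hσ : ∀ t ∈ σ, t ∈ τ) :
    (σ.map (coverWeight τ)).sum (some p) = disp M σ p := by
  induction σ with
  | nil => rfl
  | cons t σ ih =>
    have hO : t.O p ≠ ⊤ := fun hO => h ⟨t, hσ t List.mem_cons_self, hO⟩
    rw [List.map_cons, List.sum_cons, Pi.add_apply, coverWeight, if_neg h,
      ih fun s hs => hσ s (List.mem_cons_of_mem _ hs), disp_cons, Pi.add_apply,
      effAt_of_ne_top hO, effAt_of_ne_top hO]

/-- Effects of `ω`-outputs grow with `M` and cannot serve as weights bounded by `R`. It suffices to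
keep one `ω`-output for each place that has one in `τ`, and then to raise `M` until it outweighs all
losses. -/
theorem SelfCovers.exists_short_of_bounded [Fintype P] {N : OmegaPN P} {S : Finset P} {M h : ℕ}
    (hh : 1 ≤ h) (hM : h ≤ M) {σ τ : List (OmegaTransition P)} {m : P → ℤ}
    (hm : ∀ p ∈ S, 0 ≤ m p) (hc : N.SelfCovers S M m σ τ)
    (hb : ∀ α β, σ ++ τ = α ++ β → ∀ p ∈ S, m p + disp M α p < h) :
    ∃ M' ≥ M, ∃ σ' τ', N.SelfCovers S M' m σ' τ' ∧ σ'.length + τ'.length ≤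
      h ^ Fintype.card P * h ^ Fintype.card P + h ^ Fintype.card P +
        walkBound (h ^ Fintype.card P) N.R (Fintype.card P + 1) := by
  classical
  obtain ⟨hT, hne, hf, hd⟩ := hc
  obtain ⟨hf1, hf2⟩ := sFires_append.1 hf
  obtain ⟨σ', hσ'T, hσ'len, hσ'⟩ := exists_short_sFires hh hM
    (fun t ht => hT t (List.mem_append_left _ ht)) hm hf1
    (fun α β hαβ => hb α (β ++ τ) (by rw [hαβ, List.append_assoc]))
  obtain ⟨w, hw, hwτ, hv, hx⟩ := exists_isWalk_of_sFires hh
    (fun t ht => hT t (List.mem_append_right _ ht)) (hf1.nonneg hm) hf2 (fun α β hαβ p hp => by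
      have := hb (σ ++ α) β (by rw [hαβ, List.append_assoc]) p hp
      simp only [disp_append, Pi.add_apply] at this ⊢
      omega)
  -- The coordinate `none` keeps the covering part nonempty; the others ask for an `ω`-output or a
  -- nonnegative effect.
  let b : Option P → ℤ := fun o => o.elim 1 fun p => if ∃ s ∈ τ, s.O p = ⊤ then 1 else 0
  have hR := N.one_le_R
  have hmap : ∀ w : List (Edge P), w.map (fun e => coverWeight τ e.2.1) =
      (w.map (·.2.1)).map (coverWeight τ) := fun w => by simp
  obtain ⟨w', hw', hv', hlen', hb'⟩ := exists_short_walk _ _ (fun e : Edge P => coverWeight τ e.2.1)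
    (fun e => N.ValidEdge S M h e ∧ e.2.1 ∈ τ) N.R hR (fun e he o => by
      rcases o with _ | p
      · simp only [coverWeight, abs_one]; exact_mod_cast hR
      · simp only [coverWeight]
        split_ifs with h1 h2
        · rw [abs_one]; exact_mod_cast hR
        · rw [abs_zero]; positivity
        · exact N.abs_effAt_le_R he.1.1 (fun hO => h1 ⟨_, he.2, hO⟩) 0) b (fun o => by
      rcases o with _ | p
      · simp only [b, Option.elim_none, abs_one]; exact_mod_cast hR
      · simp only [b, Option.elim_some]
        split_ifs
        · rw [abs_one]; exact_mod_cast hR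
        · rw [abs_zero]; positivity) (box P h) w hw
    (fun e he => ⟨hv e he, hwτ ▸ List.mem_map_of_mem he⟩) hx (fun o => by
      rw [hmap, hwτ]
      rcases o with _ | p
      · rw [sum_coverWeight_none]
        have := List.length_pos_of_ne_nil hne
        simp only [b, Option.elim_none]
        omega
      · simp only [b, Option.elim_some]
        split_ifs with h1
        · exact (one_le_sum_coverWeight_iff h1).2.2 h1
        · rw [sum_coverWeight_some M h1 fun t ht => ht]
          exact hd p)
  set τ' := w'.map (·.2.1) with hτ'
  have hτ'τ : ∀ t ∈ τ', t ∈ τ := by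
    intro t ht
    obtain ⟨e, he, rfl⟩ := List.mem_map.1 ht
    exact (hv' e he).2
  have hτ'T : ∀ t ∈ τ', t ∈ N.T := fun t ht => hT t (List.mem_append_right _ (hτ'τ t ht))
  rw [hmap, ← hτ'] at hb'
  -- `τ'` removes at most `τ'.length * N.R` tokens from a place, so one `ω`-output of this size
  -- compensates.
  refine ⟨M + τ'.length * N.R, Nat.le_add_right _ _, σ', τ', ⟨fun t ht => ?_, ?_, ?_, fun p => ?_⟩,
    ?_⟩
  · exact (List.mem_append.1 ht).elim (hσ'T t) (hτ'T t)
  · have h1 := hb' none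
    rw [sum_coverWeight_none] at h1
    simp only [b, Option.elim_none] at h1
    exact List.ne_nil_of_length_pos (by omega)
  · obtain ⟨h1, h2⟩ := hσ' (M + τ'.length * N.R)
    refine sFires_append.2 ⟨h1, (sFires_of_isWalk (h := h) ?_ hw' fun e he => (hv' e he).1.mono hM).1⟩
    rw [proj_eq_iff]
    intro p hp
    rw [proj_apply hp]
    exact h2 p hp
  · have h1 := hb' (some p)
    simp only [b, Option.elim_some] at h1
    split_ifs at h1 with h2
    · have h3 := (le_disp_of_exists_top (M := M + τ'.length * N.R) hτ'T p).2
        ((one_le_sum_coverWeight_iff h2).2.1 h1)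
      push_cast at h3
      omega
    · rwa [sum_coverWeight_some _ h2 hτ'τ] at h1
  · rw [card_box, Fintype.card_option] at hlen'
    rw [hτ', List.length_map]
    omega

end OmegaPN

/-! ### Arithmetic of the bounds. -/

theorem summandBound_le {b a K B : ℕ} (hb : 2 ≤ b) (ha : 2 ≤ a) (hK : K ≤ b ^ a)
    (hB : B ≤ b ^ (3 * a)) : summandBound a K B ≤ b ^ (9 * a ^ 3) := by
  have hmono : ∀ {i j : ℕ}, i ≤ j → b ^ i ≤ b ^ j := fun h => Nat.pow_le_pow_right (by omega) h
  have h4 : 4 ≤ b ^ 2 := Nat.pow_le_pow_left hb 2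
  have hpos : ∀ i, 1 ≤ b ^ i := fun i => Nat.one_le_pow _ _ (by omega)
  have h1 : 2 * K + 1 ≤ b ^ (2 * a) := by
    calc 2 * K + 1 ≤ 4 * b ^ a := by have := hpos a; omega
      _ ≤ b ^ 2 * b ^ a := Nat.mul_le_mul_right _ h4
      _ = b ^ (2 + a) := (pow_add _ _ _).symm
      _ ≤ b ^ (2 * a) := hmono (by omega)
  have h2 : a + 1 ≤ b ^ a := Nat.lt_two_pow_self.trans_le (Nat.pow_le_pow_left hb a)
  have h3 : (2 * K + 1) ^ a ≤ b ^ (2 * a ^ 2) := by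
    calc (2 * K + 1) ^ a ≤ (b ^ (2 * a)) ^ a := Nat.pow_le_pow_left h1 a
      _ = _ := by rw [← pow_mul]; congr 1; ring
  have h5 : ((a + 1) * K) ^ a ≤ b ^ (2 * a ^ 2) := by
    calc ((a + 1) * K) ^ a ≤ (b ^ a * b ^ a) ^ a := Nat.pow_le_pow_left (Nat.mul_le_mul h2 hK) a
      _ = _ := by rw [← pow_add, ← pow_mul]; congr 1; ring
  have h6 : B + (2 * K + 1) ^ a * ((a + 1) * K) ^ a * K + K ≤ b ^ (6 * a ^ 2) := by
    have e1 : B ≤ b ^ (5 * a ^ 2) := hB.trans (hmono (by nlinarith))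
    have e2 : K ≤ b ^ (5 * a ^ 2) := hK.trans (hmono (by nlinarith))
    have e3 : (2 * K + 1) ^ a * ((a + 1) * K) ^ a * K ≤ b ^ (5 * a ^ 2) := by
      calc _ ≤ b ^ (2 * a ^ 2) * b ^ (2 * a ^ 2) * b ^ a :=
            Nat.mul_le_mul (Nat.mul_le_mul h3 h5) hK
        _ = b ^ (2 * a ^ 2 + 2 * a ^ 2 + a) := by rw [pow_add, pow_add]
        _ ≤ _ := hmono (by nlinarith)
    calc _ ≤ 4 * b ^ (5 * a ^ 2) := by omega
      _ ≤ b ^ 2 * b ^ (5 * a ^ 2) := Nat.mul_le_mul_right _ h4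
      _ = b ^ (2 + 5 * a ^ 2) := (pow_add _ _ _).symm
      _ ≤ _ := hmono (by nlinarith)
  rw [summandBound]
  calc _ ≤ b ^ (2 * a ^ 2) * (b ^ a * b ^ (6 * a ^ 2)) ^ a :=
        Nat.mul_le_mul h3 (Nat.pow_le_pow_left (Nat.mul_le_mul h2 h6) a)
    _ = b ^ (2 * a ^ 2 + (a + 6 * a ^ 2) * a) := by rw [← pow_add, ← pow_mul, ← pow_add]
    _ ≤ _ := hmono (by
      have : 2 * a ^ 2 ≤ a ^ 3 := by rw [pow_succ a 2, mul_comm]; exact Nat.mul_le_mul_left _ ha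
      nlinarith)

/-- One estimate for both cases of the induction: `walkBound` pays for a bounded covering part, and
`1 + h` for the step that reaches `h` together with the continuation of length at most `ℓ(i) ≤ h`.
The exponent `3 + 10(q + 1)^3` is at most `83q^3`, so `104` leaves room. -/
theorem length_bound {q h R : ℕ} (hq : 1 ≤ q) (hh : 1 ≤ h) (hR : 1 ≤ R) :
    h ^ q * h ^ q + h ^ q + 1 + h + walkBound (h ^ q) R (q + 1) ≤
      (h * (2 * R)) ^ (104 * q ^ 3) := by
  set b := h * (2 * R) with hb
  have hb2 : 2 ≤ b := by nlinarith
  have hhb : h ≤ b := Nat.le_mul_of_pos_right _ (by omega)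
  have hRb : R ≤ b := by nlinarith
  have hmono : ∀ {i j : ℕ}, i ≤ j → b ^ i ≤ b ^ j := fun h => Nat.pow_le_pow_right (by omega) h
  have hpos : ∀ i, 1 ≤ b ^ i := fun i => Nat.one_le_pow _ _ (by omega)
  have hn : h ^ q ≤ b ^ q := Nat.pow_le_pow_left hhb q
  have hnn : h ^ q * h ^ q ≤ b ^ (2 * q) := (Nat.mul_le_mul hn hn).trans_eq (by ring)
  generalize h ^ q = n at *
  have hn2 : n ≤ b ^ (2 * q) := hn.trans (hmono (by omega))
  have h4 : 4 ≤ b ^ 2 := Nat.pow_le_pow_left hb2 2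
  have hK : n * R ≤ b ^ (q + 1) := (Nat.mul_le_mul hn hRb).trans_eq (pow_succ _ _).symm
  have hB : (n * n + n) * R + R ≤ b ^ (3 * (q + 1)) := by
    have := hpos (2 * q)
    calc (n * n + n) * R + R = (n * n + n + 1) * R := by ring
      _ ≤ (4 * b ^ (2 * q)) * b := Nat.mul_le_mul (by omega) hRb
      _ ≤ (b ^ 2 * b ^ (2 * q)) * b := by gcongr
      _ = b ^ (2 + 2 * q + 1) := by ring
      _ ≤ _ := hmono (by omega)
  have hG := summandBound_le hb2 (by omega) hK hB
  have ha3 : q + 1 ≤ (q + 1) ^ 3 := Nat.le_self_pow (by norm_num) _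
  have hW : summandBound (q + 1) (n * R) ((n * n + n) * R + R) * n ≤ b ^ (10 * (q + 1) ^ 3) := by
    calc _ ≤ b ^ (9 * (q + 1) ^ 3) * b ^ q := Nat.mul_le_mul hG hn
      _ = b ^ (9 * (q + 1) ^ 3 + q) := (pow_add _ _ _).symm
      _ ≤ _ := hmono (by omega)
  have h2q : b ^ (2 * q) ≤ b ^ (10 * (q + 1) ^ 3) := hmono (by omega)
  have h1b : h ≤ b ^ (10 * (q + 1) ^ 3) :=
    hhb.trans ((pow_one b).symm.le.trans (hmono (by omega)))
  have h1 := hpos (10 * (q + 1) ^ 3)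
  have hcube : (q + 1) ^ 3 ≤ 8 * q ^ 3 := by
    calc (q + 1) ^ 3 ≤ (2 * q) ^ 3 := Nat.pow_le_pow_left (by omega) 3
      _ = _ := by ring
  rw [walkBound]
  calc _ ≤ 8 * b ^ (10 * (q + 1) ^ 3) := by omega
    _ ≤ b ^ 3 * b ^ (10 * (q + 1) ^ 3) := Nat.mul_le_mul_right _ (Nat.pow_le_pow_left hb2 3)
    _ = b ^ (3 + 10 * (q + 1) ^ 3) := (pow_add _ _ _).symm
    _ ≤ _ := hmono (by omega)

theorem rackoffEll_le (c R q : ℕ) (hc : 1 ≤ c) (hR : 1 ≤ R) (i : ℕ) :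
    rackoffEll c R q i ≤ (2 * R) ^ ((3 * c) ^ (i + 1) * q ^ (3 * (i + 1))) := by
  rcases Nat.eq_zero_or_pos q with rfl | hq
  · cases i <;> simp [rackoffEll]
  induction i with
  | zero =>
    refine Nat.pow_le_pow_right (by omega) ?_
    rw [zero_add, pow_one, mul_one]
    exact Nat.mul_le_mul_right _ (by omega)
  | succ i ih =>
    set e := (3 * c) ^ (i + 1) * q ^ (3 * (i + 1)) with he
    have he1 : 1 ≤ e := Nat.mul_pos (by positivity) (by positivity)
    calc rackoffEll c R q (i + 1)
        = ((2 * R * rackoffEll c R q i) * (2 * R)) ^ (c * q ^ 3) := rfl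
      _ ≤ ((2 * R * (2 * R) ^ e) * (2 * R)) ^ (c * q ^ 3) := by gcongr
      _ = (2 * R) ^ ((e + 2) * (c * q ^ 3)) := by rw [pow_mul _ (e + 2)]; congr 1; ring
      -- The factor `3` in `k = 3c` comes from `e + 2 ≤ 3e`, valid since `e ≥ 1`.
      _ ≤ (2 * R) ^ ((3 * e) * (c * q ^ 3)) :=
          Nat.pow_le_pow_right (by omega) (Nat.mul_le_mul_right _ (by omega))
      _ = _ := by rw [he]; congr 1; ring

theorem one_le_rackoffEll (c R q : ℕ) (hR : 1 ≤ R) (i : ℕ) : 1 ≤ rackoffEll c R q i := by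
  induction i with
  | zero => exact Nat.one_le_pow _ _ (by omega)
  | succ i ih => exact Nat.one_le_pow _ _ (by positivity)

theorem List.forall_prefix_or_exists_minimal {α : Type*} (Q : List α → Prop) (l : List α) :
    (∀ a b, l = a ++ b → Q a) ∨
      ∃ a b, l = a ++ b ∧ ¬ Q a ∧ ∀ a' b', b' ≠ [] → a = a' ++ b' → Q a' := by
  classical
  by_cases h : ∃ k, ¬ Q (l.take k)
  · refine Or.inr ⟨l.take (Nat.find h), l.drop (Nat.find h), (List.take_append_drop _ _).symm,
      Nat.find_spec h, fun a' b' hb' hab => ?_⟩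
    have h1 : a'.length < Nat.find h := by
      have := congrArg List.length hab
      have := List.length_pos_of_ne_nil hb'
      simp only [List.length_take, List.length_append] at *
      omega
    have h2 := Nat.find_min h h1
    rw [not_not] at h2
    have h3 : l = a' ++ (b' ++ l.drop (Nat.find h)) := by
      rw [← List.append_assoc, ← hab, List.take_append_drop]
    rw [h3] at h2
    simpa using h2
  · push Not at h
    refine Or.inl fun a b hab => ?_
    have := h a.length
    rw [hab] at this
    simpa using this

/-! ### Rackoff's induction and the main theorem. -/

namespace OmegaPN

open OmegaTransition

/-- The statement ranges over all starting markings and all `M`, since the induction hypothesis is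
applied after a prefix, with one place dropped from `S`, and may raise `M`. -/
theorem exists_short_selfCovers {P : Type*} [Fintype P] (N : OmegaPN P)
    (hP : 1 ≤ Fintype.card P) (i : ℕ) : ∀ (S : Finset P), S.card = i → ∀ (M : ℕ) (m : P → ℤ)
      (σ τ : List (OmegaTransition P)), (∀ p ∈ S, 0 ≤ m p) → N.SelfCovers S M m σ τ →
      ∃ M' ≥ M, ∃ σ' τ', N.SelfCovers S M' m σ' τ' ∧
        σ'.length + τ'.length ≤ rackoffEll 104 N.R (Fintype.card P) i := by
  classical
  have hR := N.one_le_R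
  induction i with
  | zero =>
    intro S hS M m σ τ hm hc
    rw [Finset.card_eq_zero] at hS
    subst hS
    -- With no constrained place the graph has a single vertex, so `h = 1` works.
    obtain ⟨M', hM', σ', τ', hc', hlen⟩ := (hc.mono subset_rfl (le_max_left M 1)).exists_short_of_bounded
      le_rfl (le_max_right _ _) hm (by simp)
    refine ⟨M', (le_max_left _ _).trans hM', σ', τ', hc', ?_⟩
    have := length_bound hP le_rfl hR
    rw [one_mul] at this
    rw [rackoffEll]
    omega
  | succ i ih =>
    intro S hS M m σ τ hm hc
    set h := 2 * N.R * rackoffEll 104 N.R (Fintype.card P) i with hh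
    have hell := one_le_rackoffEll 104 N.R (Fintype.card P) hR i
    have hh1 : 1 ≤ h := Nat.mul_pos (by omega) hell
    have hbound := length_bound hP hh1 hR
    have hlast : rackoffEll 104 N.R (Fintype.card P) (i + 1) =
      (h * (2 * N.R)) ^ (104 * Fintype.card P ^ 3) := rfl
    rw [hlast]
    obtain ⟨M₁, hMM₁, hhM₁⟩ : ∃ M₁, M ≤ M₁ ∧ h ≤ M₁ := ⟨max M h, le_max_left _ _, le_max_right _ _⟩
    have hc := hc.mono subset_rfl hMM₁
    rcases List.forall_prefix_or_exists_minimal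
      (fun α => ∀ p ∈ S, m p + disp M₁ α p < h) (σ ++ τ) with hb | ⟨α, β, hαβ, hα, hmin⟩
    · obtain ⟨M', hM', σ', τ', hc', hlen⟩ := hc.exists_short_of_bounded hh1 hhM₁ hm hb
      exact ⟨M', hMM₁.trans hM', σ', τ', hc', by omega⟩
    · push Not at hα
      obtain ⟨p, hp, hpα⟩ := hα
      have hf := hc.2.2.1
      have hT := hc.1
      rw [hαβ] at hf hT
      have hfα := (sFires_append.1 hf).1
      have hTα : ∀ t ∈ α, t ∈ N.T := fun t ht => hT t (List.mem_append_left _ ht)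
      -- All proper prefixes of `α` stay below `h`, so everything but its last transition can be
      -- shortened; hence the `+ 1`. The result must hold for every `M' ≥ M₁`, because the
      -- continuation chooses `M'` later.
      obtain ⟨α', hα'T, hα'len, hα'⟩ : ∃ α' : List (OmegaTransition P), (∀ t ∈ α', t ∈ N.T) ∧
          α'.length ≤ h ^ Fintype.card P * h ^ Fintype.card P + h ^ Fintype.card P + 1 ∧
          ∀ M' ≥ M₁, SFires S M' m α' ∧ ∀ p ∈ S, m p + disp M₁ α p ≤ m p + disp M' α' p := by
        rcases List.eq_nil_or_concat' α with rfl | ⟨α₀, t, rfl⟩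
        · exact ⟨[], by simp, by simp, fun M' _ => ⟨trivial, by simp⟩⟩
        · obtain ⟨hf0, hft⟩ := sFires_append.1 hfα
          obtain ⟨α₀', hT', hlen', h'⟩ := exists_short_sFires hh1 hhM₁
            (fun s hs => hTα s (List.mem_append_left _ hs)) hm hf0
            (fun a b hab => hmin a (b ++ [t]) (by simp) (by rw [hab, List.append_assoc]))
          refine ⟨α₀' ++ [t], ?_, ?_, fun M' hM' => ⟨sFires_append.2 ⟨(h' M').1,
            hft.mono subset_rfl hM' fun q hq => ((h' M').2 q hq).ge⟩, fun q hq => ?_⟩⟩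
          · intro s hs
            rcases List.mem_append.1 hs with hs | hs
            · exact hT' s hs
            · exact hTα s (List.mem_append_right _ hs)
          · rw [List.length_append, List.length_singleton]; omega
          · have h1 := (h' M').2 q hq
            have h2 := effAt_mono hM' t q
            simp only [disp_append, disp_cons, disp_nil, Pi.add_apply, Pi.zero_apply]
            omega
      obtain ⟨σ₂, τ₂, hc₂⟩ := hc.exists_after_prefix hαβ
      obtain ⟨M', hM', σ₃, τ₃, hc₃, hlen₃⟩ := ih (S.erase p) (by
          rw [Finset.card_erase_of_mem hp, hS]; rfl) M₁ (m + disp M₁ α) σ₂ τ₂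
        (fun q hq => hfα.nonneg hm q (Finset.mem_of_mem_erase hq))
        (hc₂.mono (Finset.erase_subset _ _) le_rfl)
      obtain ⟨hT₃, hne₃, hf₃, hd₃⟩ := hc₃
      obtain ⟨hα'f, hα'd⟩ := hα' M' hM'
      have hlenR : (σ₃ ++ τ₃).length * N.R ≤ h := by
        rw [List.length_append]
        calc _ ≤ rackoffEll 104 N.R (Fintype.card P) i * N.R := Nat.mul_le_mul_right _ hlen₃
          _ ≤ h := by rw [hh]; nlinarith
      -- The place `p` holds at least `h` tokens, enough for the whole continuation, so it can be
      -- put back into `S`.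
      have hf₄ : SFires S M' (m + disp M₁ α) (σ₃ ++ τ₃) :=
        SFires.insert (R := N.R) (fun t ht => N.need_le_R (hT₃ t ht) p)
          (le_trans (by exact_mod_cast hlenR) hpα) hf₃
      refine ⟨M', hMM₁.trans hM', α' ++ σ₃, τ₃, ⟨?_, hne₃, ?_, hd₃⟩, ?_⟩
      · intro t ht
        rw [List.append_assoc] at ht
        exact (List.mem_append.1 ht).elim (hα'T t) (hT₃ t)
      · rw [List.append_assoc]
        exact sFires_append.2 ⟨hα'f, hf₄.mono subset_rfl le_rfl hα'd⟩
      · have h1 : rackoffEll 104 N.R (Fintype.card P) i ≤ h := by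
          rw [hh]; exact Nat.le_mul_of_pos_left _ (by omega)
        rw [List.length_append]
        omega

end OmegaPN

theorem mainTheorem3 :
    ∃ c : ℕ, ∀ (P : Type*) [Fintype P] (N : OmegaPN P),
      (∀ σ : List (OmegaTransition P), N.IsSelfCovering σ →
        ∃ σ' : List (OmegaTransition P), N.IsSelfCovering σ' ∧
          σ'.length ≤ rackoffEll c N.R (Fintype.card P) (Fintype.card P)) ∧
      (∀ i : ℕ, rackoffEll c N.R (Fintype.card P) i ≤
        (2 * N.R) ^ ((3 * c) ^ (i + 1) * Fintype.card P ^ (3 * (i + 1)))) := by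
  refine ⟨104, fun P _ N => ⟨fun σ hσ => ?_, rackoffEll_le _ _ _ (by norm_num) N.one_le_R⟩⟩
  -- Without places `length_bound` does not apply, but any single transition is already
  -- self-covering.
  rcases Nat.eq_zero_or_pos (Fintype.card P) with h0 | h0
  · have := Fintype.card_eq_zero_iff.1 h0
    obtain ⟨σ₁, σ₂, m, m', -, hne, -, h2, -⟩ := hσ
    cases h2 with
    | nil => exact absurd rfl hne
    | @cons _ m₁ _ t σ' ht _ _ =>
      refine ⟨[t], ⟨[], [t], N.m₀, m₁, rfl, by simp, .nil _,
        .cons ht ⟨0, 0, fun p => isEmptyElim p⟩ (.nil _), fun p => isEmptyElim p⟩, ?_⟩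
      exact one_le_rackoffEll _ _ _ N.one_le_R _
  · obtain ⟨M, σ₁, σ₂, hc⟩ := hσ.exists_selfCovers
    obtain ⟨M', -, σ', τ', hc', hlen⟩ := N.exists_short_selfCovers h0 _ Finset.univ rfl M _ σ₁ σ₂
      (fun p _ => Nat.cast_nonneg _) hc
    exact ⟨σ' ++ τ', hc'.isSelfCovering, by rw [List.length_append]; exact hlen⟩
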